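/- **Setting.** An *orthonormal ensemble* is a finite list of real random variables $Z_0=1,Z_1,\dots,Z_m$ on a probability space with $\mathbf E[Z_rZ_s]=\delta_{rs}$. A *sequence of ensembles* $\mathcal Z=(\mathcal Z_1,\dots,\mathcal Z_n)$, $\mathcal Z_i=\{Z_{i,0}=1,\dots,Z_{i,m_i}\}$, consists of $n$ orthonormal ensembles that are independent of each other. A multi-index is $\sigma=(\sigma_1,\dots,\sigma_n)$ with $0\le\sigma_i\le m_i$; its degree is $|\sigma|=\#\{i:\sigma_i>0\}$. A multilinear polynomial is $Q(x)=\sum_\sigma c_\sigma\prod_i x_{i,\sigma_i}$ with real $c_\sigma$; put $T_\rho Q=\sum_\sigma\rho^{|\sigma|}c_\sigma x_\sigma$, $Q^{>d}=\sum_{|\sigma|>d}c_\sigma x_\sigma$, and, for real $D$, $\mathrm{Inf}_i^{\le D}(Q)=\sum_{|\sigma|\le D,\ \sigma_i>0}c_\sigma^2$. A $k$-dimensional multilinear polynomial is $Q=(Q_1,\dots,Q_k)$; $\mathbf{Var}[Q]=\mathbf E\|Q(\mathcal X)-\mathbf E Q(\mathcal X)\|_2^2$ and $\mathrm{Inf}_i^{\le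 D}(Q)=\sum_j\mathrm{Inf}_i^{\le D}(Q_j)$. The sequence $\mathcal Z$ is $(p,q,\eta)$-hypercontractive if $\|(T_\eta Q)(\mathcal Z)\|_q\le\|Q(\mathcal Z)\|_p$ for every multilinear polynomial $Q$ over $\mathcal Z$. Let $f_{[0,1]}(x)=\max(\min(x,1),0)$ and, on $\mathbb R^k$, $\zeta(x)=\sum_{i=1}^k(x_i-f_{[0,1]}(x_i))^2$, $\chi(x)=\prod_{i=1}^k f_{[0,1]}(x_i)$. **Hypothesis H3.** Let $0<\alpha\le 1/2$. For each $i$, $\mathcal X_i$ is an orthonormal ensemble that is a basis of the real functions (modulo null sets) on a finite probability space $\Omega_i$ all of whose atoms of nonzero probability have probability at least $\alpha$; $\mathcal X=(\mathcal X_1,\dots,\mathcal X_n)$ lives on the product space $\Omega_1\times\dots\times\Omega_n$. With $\eta=\tfrac12\alpha^{1/6}$, $\mathcal Y$ is a $(2,3,\eta)$-hypercontractive sequence of ensembles with $|\mathcal Y_i|=|\mathcal X_i|$ for all $i$, all of whose random variables $Y_{i,r}$ are independent. Write $K=\log(1/\alpha)$. **Theorem.** For every $k$ there are constants $c,C>0$,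 depending only on $k$, such that the following two assertions hold. (1) Assume H3, let $\tau>0$, $0<\gamma<1$, and let $Q$ be a $k$-dimensional multilinear polynomial with $\mathbf{Var}[Q]\le1$, with $\mathrm{Inf}_i^{\le\log(1/\tau)/K}(Q)\le\tau$ for all $i$, and with $\mathbf{Var}[Q^{>d}]\le(1-\gamma)^{2d}$ for all integers $d\ge0$. Then, with $R=Q(\mathcal X)$ and $S=Q(\mathcal Y)$, $$\bigl|\mathbf E[\zeta(R)]-\mathbf E[\zeta(S)]\bigr|\le C\,\tau^{c\gamma/K},\qquad \bigl|\mathbf E[\chi(R)]-\mathbf E[\chi(S)]\bigr|\le\tau^{c\gamma/K}.$$ (2) Assume H3, let $\tau>0$ and $0<\gamma<1$. For $1\le i\le n$, $1\le j\le k$ let $\mathcal X_i^j=\{X_{i,s}^j\}_{0\le s\le m_i^j}$ and $\mathcal Y_i^j=\{Y_{i,s}^j\}_{0\le s\le m_i^j}$ be orthonormal ensembles (with $X_{i,0}^j=Y_{i,0}^j=1$) given by linear combinations with the same coefficients, $X^j_{i,s}=\sum_r a(i,j,s,r)X_{i,r}$ and $Y^j_{i,s}=\sum_r a(i,j,s,r)Y_{i,r}$.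 Put $\mathcal X^j=(\mathcal X^j_1,\dots,\mathcal X^j_n)$ and $\mathcal Y^j=(\mathcal Y^j_1,\dots,\mathcal Y^j_n)$. Let $Q=(Q_1,\dots,Q_k)$, where $Q_j$ is a multilinear polynomial over $\mathcal X^j$, satisfy $\mathbf{Var}[Q]=\sum_j\mathbf{Var}[Q_j(\mathcal X^j)]\le1$, $\mathrm{Inf}_i^{\le\log(1/\tau)/K}(Q)\le\tau$ for all $i$, and $\mathbf{Var}[Q_j^{>d}(\mathcal X^j)]\le(1-\gamma)^{2d}$ for all $j$ and all integers $d\ge0$. Then the same two bounds hold for $R=(Q_1(\mathcal X^1),\dots,Q_k(\mathcal X^k))$ and $S=(Q_1(\mathcal Y^1),\dots,Q_k(\mathcal Y^k))$. -/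

import Mathlib

open MeasureTheory ProbabilityTheory
open scoped ENNReal

universe u v

noncomputable section

namespace MLInv

/-! Orthonormal ensembles and sequences of ensembles -/

/-- An orthonormal ensemble on the probability space `(S, P)`: finitely many real random variables
`Z 0 = 1, Z 1, …, Z m`, orthonormal in `L²(P)`. -/
structure IsOrthonormalEnsemble {S : Type*} [MeasurableSpace S] (P : Measure S) {m : ℕ}
    (Z : Fin (m + 1) → S → ℝ) : Prop where
  measurable : ∀ r, Measurable (Z r)
  memLp : ∀ r, MemLp (Z r) 2 P
  zero_eq_one : ∀ ω, Z 0 ω = 1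
  orthonormal : ∀ r s, ∫ ω, Z r ω * Z s ω ∂P = if r = s then 1 else 0

/-- A sequence of ensembles: `n` orthonormal ensembles on a common probability space which are
independent families of random variables. -/
structure IsEnsembleSeq {S : Type*} [MeasurableSpace S] (P : Measure S) {n : ℕ} {m : Fin n → ℕ}
    (Z : ∀ i, Fin (m i + 1) → S → ℝ) : Prop where
  ensemble : ∀ i, IsOrthonormalEnsemble P (Z i)
  indep : iIndepFun (fun i ω r => Z i r ω) P

/-- The sequence of random variables on the product space `Ω₁ × ⋯ × Ωₙ` obtained from
random variables `φ i r` on the factors. -/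
def productSeq {n : ℕ} {m : Fin n → ℕ} {Ω : Fin n → Type*}
    (φ : ∀ i, Fin (m i + 1) → Ω i → ℝ) : ∀ i, Fin (m i + 1) → (∀ i, Ω i) → ℝ :=
  fun i r ω => φ i r (ω i)

/-- The families of linear combinations `∑ r, a i s r * Z i r` of the members of the `i`-th
family of `Z`. -/
def linComb {S : Type*} {n : ℕ} {m M : Fin n → ℕ}
    (a : ∀ i, Fin (M i + 1) → Fin (m i + 1) → ℝ) (Z : ∀ i, Fin (m i + 1) → S → ℝ) :
    ∀ i, Fin (M i + 1) → S → ℝ :=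
  fun i s ω => ∑ r, a i s r * Z i r ω

/-! Multilinear polynomials -/

/-- Multi-indices `σ = (σ₁, …, σₙ)` with `0 ≤ σᵢ ≤ mᵢ`. -/
abbrev MultiIndex {n : ℕ} (m : Fin n → ℕ) : Type := ∀ i, Fin (m i + 1)

/-- The degree `|σ| = #{i : σᵢ > 0}`. -/
def MultiIndex.degree {n : ℕ} {m : Fin n → ℕ} (σ : MultiIndex m) : ℕ :=
  (Finset.univ.filter (fun i => σ i ≠ 0)).card

/-- A multilinear polynomial `∑ σ, c σ * x_σ`, given by its coefficients. -/
abbrev MultilinearPoly {n : ℕ} (m : Fin n → ℕ) : Type := MultiIndex m → ℝ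

/-- The random variable `Q(Z) = ∑ σ, c σ * ∏ i, Z i (σ i)`. -/
def MultilinearPoly.apply {S : Type*} {n : ℕ} {m : Fin n → ℕ} (Q : MultilinearPoly m)
    (Z : ∀ i, Fin (m i + 1) → S → ℝ) : S → ℝ :=
  fun ω => ∑ σ, Q σ * ∏ i, Z i (σ i) ω

/-- `T_ρ Q = ∑ σ, ρ^|σ| c σ x_σ`. -/
def MultilinearPoly.noise {n : ℕ} {m : Fin n → ℕ} (ρ : ℝ) (Q : MultilinearPoly m) :
    MultilinearPoly m :=
  fun σ => ρ ^ σ.degree * Q σ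

/-- `Q^{> d}`, the part of `Q` of degree larger than `d`. -/
def MultilinearPoly.above {n : ℕ} {m : Fin n → ℕ} (d : ℕ) (Q : MultilinearPoly m) :
    MultilinearPoly m :=
  fun σ => if d < σ.degree then Q σ else 0

/-- The low-degree influence `Inf_i^{≤ D}(Q) = ∑_{|σ| ≤ D, σᵢ > 0} c_σ²` (`D` a real number). -/
def lowInf {n : ℕ} {m : Fin n → ℕ} (D : ℝ) (i : Fin n) (Q : MultilinearPoly m) : ℝ :=
  ∑ σ with (σ.degree : ℝ) ≤ D ∧ σ i ≠ 0, Q σ ^ 2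

/-- The low-degree influence of a `k`-dimensional polynomial: the sum of those of its components.
The components may be polynomials over different families of indeterminates. -/
def vecLowInf {k n : ℕ} {M : Fin k → Fin n → ℕ} (D : ℝ) (i : Fin n)
    (Q : ∀ j, MultilinearPoly (M j)) : ℝ :=
  ∑ j, lowInf D i (Q j)

/-- The variance `E[‖F - E F‖₂²]` of a random vector `F = (F₁, …, F_k)`. -/
def vecVariance {S : Type*} [MeasurableSpace S] (P : Measure S) {k : ℕ}
    (F : Fin k → S → ℝ) : ℝ :=
  ∫ ω, ∑ j, (F j ω - ∫ ω', F j ω' ∂P) ^ 2 ∂P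

/-- `(p, q, η)`-hypercontractivity: `‖(T_η Q)(Z)‖_q ≤ ‖Q(Z)‖_p` for every multilinear
polynomial `Q`. -/
def IsHypercontractive {S : Type*} [MeasurableSpace S] (P : Measure S) {n : ℕ} {m : Fin n → ℕ}
    (Z : ∀ i, Fin (m i + 1) → S → ℝ) (p q : ℝ≥0∞) (η : ℝ) : Prop :=
  ∀ Q : MultilinearPoly m,
    eLpNorm ((Q.noise η).apply Z) q P ≤ eLpNorm (Q.apply Z) p P

/-- Hypothesis **H3**. The ensemble `𝒳ᵢ = {φ i 0 = 1, φ i 1, …}` is an orthonormal basis of the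
real functions on the finite probability space `(Ω i, μ i)` (functions that agree almost everywhere
are identified, since atoms of probability zero are allowed), every atom of positive probability has
probability at least `α`, where `0 < α ≤ 1/2`, and `Y` is a `(2, 3, α^{1/6}/2)`-hypercontractive
sequence of ensembles all of whose random variables are independent.
The sequence `𝒳` itself is `productSeq φ` on the product space. -/
structure HypothesisH3 {n : ℕ} {m : Fin n → ℕ}
    {Ω : Fin n → Type*} [∀ i, Fintype (Ω i)] [∀ i, MeasurableSpace (Ω i)]
    (μ : ∀ i, Measure (Ω i)) (φ : ∀ i, Fin (m i + 1) → Ω i → ℝ)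
    {S : Type*} [MeasurableSpace S] (P : Measure S)
    (Y : ∀ i, Fin (m i + 1) → S → ℝ) (α : ℝ) : Prop where
  alpha_pos : 0 < α
  alpha_le : α ≤ 1 / 2
  atom_ge : ∀ i x, μ i {x} ≠ 0 → α ≤ (μ i).real {x}
  ensemble : ∀ i, IsOrthonormalEnsemble (μ i) (φ i)
  spanning : ∀ i (f : Ω i → ℝ), ∃ b : Fin (m i + 1) → ℝ, f =ᵐ[μ i] fun x => ∑ r, b r * φ i r x
  ensembleSeq : IsEnsembleSeq P Y
  indep : iIndepFun (fun p : (i : Fin n) × Fin (m i + 1) => Y p.1 p.2) P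
  hypercontractive : IsHypercontractive P Y 2 3 (1 / 2 * α ^ (1 / 6 : ℝ))

/-! The test functionals -/

/-- `f_{[0,1]}(x) = max(min(x, 1), 0)`. -/
def clip (x : ℝ) : ℝ := max (min x 1) 0

/-- `ζ(x) = ∑ i, (x i - f_{[0,1]}(x i))²`. -/
def zeta {k : ℕ} (x : Fin k → ℝ) : ℝ := ∑ i, (x i - clip (x i)) ^ 2

/-- `χ(x) = ∏ i, f_{[0,1]}(x i)`. -/
def chi {k : ℕ} (x : Fin k → ℝ) : ℝ := ∏ i, clip (x i)

end MLInv

end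

open MLInv

/-! The engine is Lindeberg's replacement method. Two orthonormal ensembles have the same first and
second moments, so exchanging one of them inside a smooth function of `Q` costs only a third-order
Taylor remainder: a third absolute moment of the part of `Q` that involves that ensemble
(`exists_expansion`, `replace_one`). For degree at most `d`, hypercontractivity bounds this moment
by `η^(-3d) * Inf_i^(3/2)`. Since `Inf_i ≤ τ` and the influences sum to at most `d` times the
variance, all exchanges together cost `O(η^(-3d) * √τ * d)` (`replace_all`, `sum_sqrt_partAt_le`).

The intermediate hybrids mix ensembles of both sequences, so hypercontractivity is needed for each
ensemble separately and is then tensorized by Minkowski's inequality in `L^(3/2)` (`IsHC.prod`). For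
`Y` the single-ensemble inequality is a special case of the hypothesis. For a finite space it
follows from `|f| ≤ ‖f‖₂ / √α` for `f` in the span of the nonconstant basis elements
(`isHC_of_finite`).

Two approximations lead to the actual statement. Cutting `Q` at degree `d` costs a multiple of
`(1-γ)^d` by the tail hypothesis. The functions `ζ` and `χ` are smoothed by replacing `|x|` with
`√(x² + l²)`. With `d` about `log(1/τ)/(18K)` and `l` a small power of `τ`, every error is at most a
constant times `τ^(cγ/K)` (`invariance_of_lt_one`).

The bound for `χ` carries no constant factor. The two random vectors have the same mean and total
variance at most one, which keeps the two expectations of `χ` a definite amount less than one apart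
(`exists_chi_gap`); the constant can then be absorbed by shrinking the exponent
(`exists_exponent_absorbing`).

For linear combinations, each `Q_j` is rewritten over the original basis. This substitution
preserves the coefficient mass on every set of supports, hence variance, tails and low-degree
influences (`sum_subst_sq`), so the first assertion's core applies. -/

namespace MLInv

/-! ### Taylor estimates -/

/-- A mean value estimate on the interval `[-|h|, |h|]`. -/
lemma abs_le_mul_of_hasDerivAt {g g' : ℝ → ℝ} {M h : ℝ} (h0 : g 0 = 0)
    (hg : ∀ t, HasDerivAt g (g' t) t) (hM : ∀ t, |t| ≤ |h| → |g' t| ≤ M) :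
    |g h| ≤ M * |h| := by
  have := (convex_Icc (-|h|) |h|).norm_image_sub_le_of_norm_hasDerivWithin_le (f := g) (f' := g')
    (C := M) (x := 0) (y := h) (fun t _ => (hg t).hasDerivWithinAt)
    (fun t ht => hM t (abs_le.2 ht)) ⟨by simp, abs_nonneg h⟩ (abs_le.1 le_rfl)
  simpa [h0] using this

lemma taylor_one {f f1 : ℝ → ℝ} {M : ℝ} (hf : ∀ t, HasDerivAt f (f1 t) t)
    (hM : ∀ t, |f1 t| ≤ M) (x h : ℝ) : |f (x + h) - f x| ≤ M * |h| := by
  refine abs_le_mul_of_hasDerivAt (g := fun h => f (x + h) - f x) (g' := fun h => f1 (x + h))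
    (by simp) (fun t => ?_) (fun t _ => hM _)
  exact ((hf (x + t)).comp_const_add x t).sub_const _

/-- The derivative in `h` of a Taylor remainder of `f` is the remainder of one order less of `f1`,
so each order is one mean value estimate. The factors 1/2 and 1/6 are given away. -/
lemma taylor_two {f f1 f2 : ℝ → ℝ} {M : ℝ} (hf : ∀ t, HasDerivAt f (f1 t) t)
    (hf1 : ∀ t, HasDerivAt f1 (f2 t) t)
    (hM : ∀ t, |f2 t| ≤ M) (x h : ℝ) : |f (x + h) - f x - f1 x * h| ≤ M * |h| ^ 2 := by
  have hM0 : 0 ≤ M := (abs_nonneg _).trans (hM 0)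
  have := abs_le_mul_of_hasDerivAt (g := fun h => f (x + h) - f x - f1 x * h)
    (g' := fun h => f1 (x + h) - f1 x) (M := M * |h|) (h := h)
    (by simp) (fun t => ?_) (fun t ht => ?_)
  · calc _ ≤ _ := this
      _ = _ := by ring
  · exact ((((hf (x + t)).comp_const_add x t).sub_const _).sub
      ((hasDerivAt_id t).const_mul (f1 x))).congr_deriv (by simp)
  · exact (taylor_one hf1 hM x t).trans (by gcongr)

lemma taylor_three {f f1 f2 f3 : ℝ → ℝ} {M : ℝ} (hf : ∀ t, HasDerivAt f (f1 t) t)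
    (hf1 : ∀ t, HasDerivAt f1 (f2 t) t) (hf2 : ∀ t, HasDerivAt f2 (f3 t) t)
    (hM : ∀ t, |f3 t| ≤ M) (x h : ℝ) :
    |f (x + h) - f x - f1 x * h - f2 x / 2 * h ^ 2| ≤ M * |h| ^ 3 := by
  have hM0 : 0 ≤ M := (abs_nonneg _).trans (hM 0)
  have := abs_le_mul_of_hasDerivAt (g := fun h => f (x + h) - f x - f1 x * h - f2 x / 2 * h ^ 2)
    (g' := fun h => f1 (x + h) - f1 x - f2 x * h) (M := M * |h| ^ 2) (h := h)
    (by simp) (fun t => ?_) (fun t ht => ?_)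
  · calc _ ≤ _ := this
      _ = _ := by ring
  · have h2 : HasDerivAt (fun h : ℝ => f2 x / 2 * h ^ 2) (f2 x * t) t := by
      refine ((hasDerivAt_pow 2 t).const_mul (f2 x / 2)).congr_deriv ?_
      norm_num; ring
    exact (((((hf (x + t)).comp_const_add x t).sub_const _).sub
      ((hasDerivAt_id t).const_mul (f1 x))).sub h2).congr_deriv (by simp)
  · exact (taylor_two hf1 hf2 hM x t).trans (by gcongr)

/-! ### A smooth version of the absolute value -/

/-- The smooth approximation `√(x² + l²)` of `|x|`. -/
noncomputable def softAbs (l x : ℝ) : ℝ := √(x ^ 2 + l ^ 2)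

section SoftAbs

variable {l : ℝ} (hl : 0 < l) (x : ℝ)
include hl

lemma softAbs_pos : 0 < softAbs l x := Real.sqrt_pos.2 (by positivity)

lemma softAbs_sq : softAbs l x ^ 2 = x ^ 2 + l ^ 2 := Real.sq_sqrt (by positivity)

omit hl in
lemma le_softAbs : l ≤ softAbs l x :=
  Real.le_sqrt_of_sq_le (by nlinarith [sq_nonneg x])

omit hl in
lemma abs_le_softAbs : |x| ≤ softAbs l x :=
  Real.abs_le_sqrt (by nlinarith [sq_nonneg l])

lemma softAbs_le : softAbs l x ≤ |x| + l := by
  refine Real.sqrt_le_iff.2 ⟨by positivity, ?_⟩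
  nlinarith [sq_abs x, abs_nonneg x]

lemma hasDerivAt_softAbs : HasDerivAt (softAbs l) (x / softAbs l x) x := by
  have h := ((hasDerivAt_pow 2 x).add_const (l ^ 2)).sqrt (by positivity)
  refine h.congr_deriv ?_
  rw [softAbs]; push_cast; field_simp

lemma hasDerivAt_div_softAbs :
    HasDerivAt (fun x => x / softAbs l x) (l ^ 2 / softAbs l x ^ 3) x := by
  have hs := (softAbs_pos hl x).ne'
  refine ((hasDerivAt_id x).div (hasDerivAt_softAbs hl x) hs).congr_deriv ?_
  field_simp
  simp only [id]
  linear_combination softAbs_sq hl x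

lemma hasDerivAt_sq_div_softAbs_cube :
    HasDerivAt (fun x => l ^ 2 / softAbs l x ^ 3) (-3 * l ^ 2 * x / softAbs l x ^ 5) x := by
  have hs := (softAbs_pos hl x).ne'
  refine ((hasDerivAt_const x (l ^ 2)).div ((hasDerivAt_softAbs hl x).pow 3)
    (pow_ne_zero 3 hs)).congr_deriv ?_
  simp only [Pi.pow_apply]
  field_simp
  push_cast; ring

lemma abs_div_softAbs_le : |x / softAbs l x| ≤ 1 := by
  rw [abs_div, abs_of_pos (softAbs_pos hl x)]
  exact div_le_one_of_le₀ (abs_le_softAbs x) (softAbs_pos hl x).le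

lemma abs_sq_div_softAbs_cube_le : |l ^ 2 / softAbs l x ^ 3| ≤ 1 / l := by
  have hs := softAbs_pos hl x
  rw [abs_of_pos (by positivity), div_le_div_iff₀ (by positivity) hl]
  calc l ^ 2 * l = l ^ 3 := by ring
    _ ≤ softAbs l x ^ 3 := by gcongr; exact le_softAbs x
    _ = _ := by ring

lemma abs_cube_div_softAbs_le : |-3 * l ^ 2 * x / softAbs l x ^ 5| ≤ 3 / l ^ 2 := by
  have hs := softAbs_pos hl x
  rw [abs_div, abs_of_pos (by positivity : 0 < softAbs l x ^ 5), abs_mul, abs_mul, abs_neg,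
    abs_of_pos (by norm_num : (0 : ℝ) < 3), abs_of_pos (by positivity : 0 < l ^ 2),
    div_le_div_iff₀ (by positivity) (by positivity)]
  calc 3 * l ^ 2 * |x| * l ^ 2 = 3 * (l ^ 4 * |x|) := by ring
    _ ≤ 3 * (softAbs l x ^ 4 * softAbs l x) := by
        gcongr
        · exact le_softAbs x
        · exact abs_le_softAbs x
    _ = _ := by ring

end SoftAbs

/-! ### The clipping function -/

lemma clip_nonneg (x : ℝ) : 0 ≤ clip x := le_max_right _ _

lemma clip_le_one (x : ℝ) : clip x ≤ 1 := max_le (min_le_right _ _) zero_le_one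

lemma clip_mono : Monotone clip := fun _ _ h => max_le_max (min_le_min h le_rfl) le_rfl

lemma clip_cases (x : ℝ) : (x ≤ 0 ∧ clip x = 0) ∨ (0 ≤ x ∧ x ≤ 1 ∧ clip x = x) ∨
    (1 ≤ x ∧ clip x = 1) := by
  unfold clip
  rcases le_total x 0 with h | h
  · left; exact ⟨h, by rw [min_eq_left (by linarith), max_eq_right h]⟩
  rcases le_total x 1 with h' | h'
  · right; left; exact ⟨h, h', by rw [min_eq_left h', max_eq_left h]⟩
  · right; right; exact ⟨h', by rw [min_eq_right h', max_eq_left zero_le_one]⟩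

lemma abs_clip_sub_clip_le (x y : ℝ) : |clip x - clip y| ≤ |x - y| := by
  unfold clip
  exact (abs_max_sub_max_le_abs _ _ _).trans (abs_min_sub_min_le_max _ _ _ _ |>.trans (by simp))

lemma continuous_clip : Continuous clip := by unfold clip; fun_prop

/-- Second order comparison for the squared distance to `[0, 1]`. -/
lemma abs_sq_sub_clip_sub_le (x y : ℝ) :
    |(x - clip x) ^ 2 - (y - clip y) ^ 2 - 2 * (y - clip y) * (x - y)| ≤ (x - y) ^ 2 := by
  rcases clip_cases x with ⟨h, e⟩ | ⟨h, h', e⟩ | ⟨h, e⟩ <;>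
  rcases clip_cases y with ⟨g, e'⟩ | ⟨g, g', e'⟩ | ⟨g, e'⟩ <;> rw [e, e', abs_le] <;>
  constructor <;> nlinarith

lemma clip_eq_abs (x : ℝ) : clip x = (|x| - |x - 1| + 1) / 2 := by
  rcases clip_cases x with ⟨h, e⟩ | ⟨h, h', e⟩ | ⟨h, e⟩
  · rw [e, abs_of_nonpos h, abs_of_nonpos (by linarith)]; ring
  · rw [e, abs_of_nonneg h, abs_of_nonpos (by linarith)]; ring
  · rw [e, abs_of_nonneg (by linarith), abs_of_nonneg (by linarith)]; ring

/-- The two summands are the squared positive part of `x - 1` and the squared negative part of `x`.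
Only absolute values are nonsmooth here, which is what `softSqDist` exploits. -/
lemma sq_sub_clip_eq_abs (x : ℝ) :
    (x - clip x) ^ 2 = ((x - 1) ^ 2 + (x - 1) * |x - 1|) / 2 + (x ^ 2 - x * |x|) / 2 := by
  rcases clip_cases x with ⟨h, e⟩ | ⟨h, h', e⟩ | ⟨h, e⟩
  · rw [e, abs_of_nonpos h, abs_of_nonpos (by linarith)]; ring
  · rw [e, abs_of_nonneg h, abs_of_nonpos (by linarith)]; ring
  · rw [e, abs_of_nonneg (by linarith), abs_of_nonneg (by linarith)]; ring

/-! ### Smooth approximation of the clipping function -/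

/-- Smooth approximation of `clip`. -/
noncomputable def softClip (l x : ℝ) : ℝ := (softAbs l x - softAbs l (x - 1) + 1) / 2

/-- Smooth approximation of the squared distance to `[0, 1]`. -/
noncomputable def softSqDist (l x : ℝ) : ℝ :=
  ((x - 1) ^ 2 + (x - 1) * softAbs l (x - 1)) / 2 + (x ^ 2 - x * softAbs l x) / 2

section Soft

variable {l : ℝ} (hl : 0 < l)
include hl

lemma abs_softClip_sub_clip_le (x : ℝ) : |softClip l x - clip x| ≤ l := by
  rw [softClip, clip_eq_abs, abs_le]
  have h1 := abs_le_softAbs (l := l) x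
  have h2 := abs_le_softAbs (l := l) (x - 1)
  have h3 := softAbs_le hl x
  have h4 := softAbs_le hl (x - 1)
  constructor <;> linarith

/-- With `s = softAbs l x`, one has `(s - |x|)(s + |x|) = l ^ 2` and `|x| ≤ s + |x|`. -/
lemma abs_mul_softAbs_sub_le (x : ℝ) : |x * softAbs l x - x * (|x|)| ≤ l ^ 2 := by
  rw [← mul_sub, abs_mul]
  have h1 := abs_le_softAbs (l := l) x
  have h2 := softAbs_sq hl x
  rw [abs_of_nonneg (sub_nonneg.2 h1)]
  nlinarith [sq_abs x, abs_nonneg x]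

lemma abs_softSqDist_sub_le (x : ℝ) : |softSqDist l x - (x - clip x) ^ 2| ≤ l ^ 2 := by
  rw [softSqDist, sq_sub_clip_eq_abs, abs_le]
  have h1 := abs_le.1 (abs_mul_softAbs_sub_le hl x)
  have h2 := abs_le.1 (abs_mul_softAbs_sub_le hl (x - 1))
  constructor <;> linarith [h1.1, h1.2, h2.1, h2.2]

omit hl in
lemma continuous_softClip : Continuous (softClip l) := by
  unfold softClip softAbs; fun_prop

omit hl in
lemma continuous_softSqDist : Continuous (softSqDist l) := by
  unfold softSqDist softAbs; fun_prop

/-- Estimates of every order are recorded because they are needed to multiply factors. The common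
constant is the bound on the third derivative, which dominates the lower ones since `l ≤ 1`. -/
lemma softClip_taylor (hl1 : l ≤ 1) (x : ℝ) : ∃ a b : ℝ, |a| ≤ 3 / l ^ 2 ∧ |b| ≤ 3 / l ^ 2 ∧
    ∀ h, |softClip l (x + h) - softClip l x| ≤ 3 / l ^ 2 * |h| ∧
      |softClip l (x + h) - softClip l x - a * h| ≤ 3 / l ^ 2 * |h| ^ 2 ∧
      |softClip l (x + h) - softClip l x - a * h - b * h ^ 2| ≤ 3 / l ^ 2 * |h| ^ 3 := by
  have hd0 : ∀ t, HasDerivAt (softClip l)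
      ((t / softAbs l t - (t - 1) / softAbs l (t - 1)) / 2) t := fun t =>
    (((hasDerivAt_softAbs hl t).sub
      ((hasDerivAt_softAbs hl (t - 1)).comp_sub_const t 1)).add_const 1).div_const 2
  have hd1 : ∀ t, HasDerivAt (fun t => (t / softAbs l t - (t - 1) / softAbs l (t - 1)) / 2)
      ((l ^ 2 / softAbs l t ^ 3 - l ^ 2 / softAbs l (t - 1) ^ 3) / 2) t := fun t =>
    (((hasDerivAt_div_softAbs hl t).sub
      ((hasDerivAt_div_softAbs hl (t - 1)).comp_sub_const t 1))).div_const 2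
  have hd2 : ∀ t, HasDerivAt
      (fun t => (l ^ 2 / softAbs l t ^ 3 - l ^ 2 / softAbs l (t - 1) ^ 3) / 2)
      ((-3 * l ^ 2 * t / softAbs l t ^ 5 - -3 * l ^ 2 * (t - 1) / softAbs l (t - 1) ^ 5) / 2) t :=
    fun t => (((hasDerivAt_sq_div_softAbs_cube hl t).sub
      ((hasDerivAt_sq_div_softAbs_cube hl (t - 1)).comp_sub_const t 1))).div_const 2
  have half : ∀ {a b M : ℝ}, |a| ≤ M → |b| ≤ M → |(a - b) / 2| ≤ M := by
    intro a b M ha hb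
    rw [abs_le] at *
    constructor <;> linarith [ha.1, ha.2, hb.1, hb.2]
  have hB : 1 / l ≤ 3 / l ^ 2 := by
    rw [div_le_div_iff₀ hl (by positivity)]; nlinarith
  have hB1 : (1 : ℝ) ≤ 3 / l ^ 2 := by
    rw [le_div_iff₀ (by positivity)]; nlinarith
  have b0 : ∀ t, |(t / softAbs l t - (t - 1) / softAbs l (t - 1)) / 2| ≤ 3 / l ^ 2 := fun t =>
    (half (abs_div_softAbs_le hl t) (abs_div_softAbs_le hl (t - 1))).trans hB1
  have b1 : ∀ t, |(l ^ 2 / softAbs l t ^ 3 - l ^ 2 / softAbs l (t - 1) ^ 3) / 2| ≤ 3 / l ^ 2 :=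
    fun t => (half (abs_sq_div_softAbs_cube_le hl t)
      (abs_sq_div_softAbs_cube_le hl (t - 1))).trans hB
  refine ⟨_, ((l ^ 2 / softAbs l x ^ 3 - l ^ 2 / softAbs l (x - 1) ^ 3) / 2) / 2, b0 x, ?_,
    fun h => ⟨taylor_one hd0 b0 x h, taylor_two hd0 hd1 b1 x h, taylor_three hd0 hd1 hd2
      (fun t => half (abs_cube_div_softAbs_le hl t) (abs_cube_div_softAbs_le hl (t - 1))) x h⟩⟩
  rw [abs_div, abs_two]
  linarith [b1 x, abs_nonneg ((l ^ 2 / softAbs l x ^ 3 - l ^ 2 / softAbs l (x - 1) ^ 3) / 2)]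

/-- The squares are exactly quadratic, so the remainder comes from `t * softAbs l t`, whose third
derivative is `O(1 / l)`. The coefficients need no bound, because `softZeta` is a sum and not a
product. -/
lemma softSqDist_taylor (x : ℝ) : ∃ a b : ℝ,
    ∀ h, |softSqDist l (x + h) - softSqDist l x - a * h - b * h ^ 2| ≤ 6 / l * |h| ^ 3 := by
  have e0 : ∀ t, HasDerivAt (fun t => t * softAbs l t)
      (softAbs l t + t * (t / softAbs l t)) t := fun t => by
    exact ((hasDerivAt_id t).mul (hasDerivAt_softAbs hl t)).congr_deriv (by simp)
  have e1 : ∀ t, HasDerivAt (fun t => softAbs l t + t * (t / softAbs l t))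
      (t / softAbs l t + (t / softAbs l t + t * (l ^ 2 / softAbs l t ^ 3))) t := fun t => by
    exact ((hasDerivAt_softAbs hl t).add
      ((hasDerivAt_id t).mul (hasDerivAt_div_softAbs hl t))).congr_deriv (by simp)
  have e2 : ∀ t, HasDerivAt
      (fun t => t / softAbs l t + (t / softAbs l t + t * (l ^ 2 / softAbs l t ^ 3)))
      (l ^ 2 / softAbs l t ^ 3 + (l ^ 2 / softAbs l t ^ 3 + (l ^ 2 / softAbs l t ^ 3
        + t * (-3 * l ^ 2 * t / softAbs l t ^ 5)))) t := fun t => by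
    exact ((hasDerivAt_div_softAbs hl t).add ((hasDerivAt_div_softAbs hl t).add
      ((hasDerivAt_id t).mul (hasDerivAt_sq_div_softAbs_cube hl t)))).congr_deriv (by simp)
  have bd : ∀ t, |l ^ 2 / softAbs l t ^ 3 + (l ^ 2 / softAbs l t ^ 3 + (l ^ 2 / softAbs l t ^ 3
        + t * (-3 * l ^ 2 * t / softAbs l t ^ 5)))| ≤ 6 / l := by
    intro t
    have hs := softAbs_pos hl t
    have h1 := abs_sq_div_softAbs_cube_le hl t
    have h2 : |t * (-3 * l ^ 2 * t / softAbs l t ^ 5)| ≤ 3 / l := by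
      have : t * (-3 * l ^ 2 * t / softAbs l t ^ 5)
          = -3 * ((t / softAbs l t) * (t / softAbs l t) * (l ^ 2 / softAbs l t ^ 3)) := by
        field_simp
      rw [this, abs_mul, abs_mul, abs_mul]
      have h3 := abs_div_softAbs_le hl t
      calc |-3| * (|t / softAbs l t| * |t / softAbs l t| * |l ^ 2 / softAbs l t ^ 3|)
          ≤ 3 * (1 * 1 * (1 / l)) := by
            rw [abs_neg, abs_of_pos (by norm_num : (0:ℝ) < 3)]; gcongr
        _ = _ := by ring
    have h6 : 6 / l = 1 / l + (1 / l + (1 / l + 3 / l)) := by ring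
    rw [h6]
    exact (abs_add_le _ _).trans (add_le_add h1 ((abs_add_le _ _).trans (add_le_add h1
      ((abs_add_le _ _).trans (add_le_add h1 h2)))))
  have key := taylor_three e0 e1 e2 bd
  set g1 := fun t => softAbs l t + t * (t / softAbs l t)
  set g2 := fun t => t / softAbs l t + (t / softAbs l t + t * (l ^ 2 / softAbs l t ^ 3))
  refine ⟨(x - 1) + x + (g1 (x - 1) - g1 x) / 2, 1 + (g2 (x - 1) - g2 x) / 4, fun h => ?_⟩
  have k1 := key x h
  have k2 := key (x - 1) h
  have : softSqDist l (x + h) - softSqDist l x - ((x - 1) + x + (g1 (x - 1) - g1 x) / 2) * h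
      - (1 + (g2 (x - 1) - g2 x) / 4) * h ^ 2
      = (((x - 1 + h) * softAbs l (x - 1 + h) - (x - 1) * softAbs l (x - 1)
          - g1 (x - 1) * h - g2 (x - 1) / 2 * h ^ 2)
        - ((x + h) * softAbs l (x + h) - x * softAbs l x - g1 x * h - g2 x / 2 * h ^ 2)) / 2 := by
    simp only [softSqDist]
    rw [show x + h - 1 = x - 1 + h by ring]
    ring
  rw [this, abs_div, abs_two, div_le_iff₀ two_pos]
  exact (abs_sub _ _).trans (by linarith)

end Soft

/-! ### Taylor estimates in several variables -/

/-- A second order Taylor expansion with a cubic remainder term, at every point. -/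
def HasCubicTaylor {k : ℕ} (Ψ : (Fin k → ℝ) → ℝ) (B : ℝ) : Prop :=
  ∀ x, ∃ (a : Fin k → ℝ) (q : Fin k → Fin k → ℝ), ∀ h,
    |Ψ (x + h) - Ψ x - ∑ j, a j * h j - ∑ j, ∑ l, q j l * (h j * h l)| ≤ B * ∑ j, |h j| ^ 3

/-- Taylor estimates of all orders up to two at `x`, with constant `B`. -/
structure TaylorAt {k : ℕ} (Ψ : (Fin k → ℝ) → ℝ) (x : Fin k → ℝ) (B : ℝ)
    (a : Fin k → ℝ) (q : Fin k → Fin k → ℝ) : Prop where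
  lin : ∀ h : Fin k → ℝ, |∑ j, a j * h j| ≤ B * ‖h‖
  quad : ∀ h : Fin k → ℝ, |∑ j, ∑ l, q j l * (h j * h l)| ≤ B * ‖h‖ ^ 2
  zero : ∀ h, |Ψ (x + h) - Ψ x| ≤ B * ‖h‖
  one : ∀ h, |Ψ (x + h) - Ψ x - ∑ j, a j * h j| ≤ B * ‖h‖ ^ 2
  two : ∀ h, |Ψ (x + h) - Ψ x - ∑ j, a j * h j - ∑ j, ∑ l, q j l * (h j * h l)| ≤ B * ‖h‖ ^ 3

/-- The remainder of a product splits into the remainders of the factors, multiplied by bounded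
values, and cross terms pairing the linear or quadratic part of `f` with a lower-order remainder of
`g`. There are at most four terms, hence the factor 4; the cross terms are why all orders are
carried along. -/
lemma TaylorAt.mul {k : ℕ} {f g : (Fin k → ℝ) → ℝ} {x : Fin k → ℝ} {B B' : ℝ}
    {a a' : Fin k → ℝ} {q q' : Fin k → Fin k → ℝ} (hf : TaylorAt f x B a q)
    (hg : TaylorAt g x B' a' q') (hf1 : ∀ y, |f y| ≤ 1) (hg1 : ∀ y, |g y| ≤ 1)
    (hB : 1 ≤ B) (hB' : 1 ≤ B') :
    TaylorAt (fun y => f y * g y) x (4 * B * B') (fun j => f x * a' j + g x * a j)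
      (fun j l => f x * q' j l + g x * q j l + a j * a' l) := by
  have lin_eq : ∀ h : Fin k → ℝ, ∑ j, (f x * a' j + g x * a j) * h j
      = f x * ∑ j, a' j * h j + g x * ∑ j, a j * h j := by
    intro h
    rw [Finset.mul_sum, Finset.mul_sum, ← Finset.sum_add_distrib]
    exact Finset.sum_congr rfl fun j _ => by ring
  have quad_eq : ∀ h : Fin k → ℝ,
      ∑ j, ∑ l, (f x * q' j l + g x * q j l + a j * a' l) * (h j * h l)
      = f x * ∑ j, ∑ l, q' j l * (h j * h l) + g x * ∑ j, ∑ l, q j l * (h j * h l)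
        + (∑ j, a j * h j) * ∑ j, a' j * h j := by
    intro h
    rw [Finset.sum_mul_sum, Finset.mul_sum, Finset.mul_sum, ← Finset.sum_add_distrib,
      ← Finset.sum_add_distrib]
    refine Finset.sum_congr rfl fun j _ => ?_
    rw [Finset.mul_sum, Finset.mul_sum, ← Finset.sum_add_distrib, ← Finset.sum_add_distrib]
    exact Finset.sum_congr rfl fun l _ => by ring
  have hBB : B ≤ B * B' := le_mul_of_one_le_right (by linarith) hB'
  have hBB' : B' ≤ B * B' := le_mul_of_one_le_left (by linarith) hB
  have one_mul_le : ∀ {u v w : ℝ}, |u| ≤ 1 → |v| ≤ w → |u * v| ≤ w := by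
    intro u v w hu hv
    rw [abs_mul]
    exact (mul_le_of_le_one_left (abs_nonneg _) hu).trans hv
  have two_le : ∀ {u v b c : ℝ}, |u| ≤ b → |v| ≤ c → |u * v| ≤ b * c := by
    intro u v b c hu hv
    rw [abs_mul]
    exact mul_le_mul hu hv (abs_nonneg _) ((abs_nonneg _).trans hu)
  refine ⟨fun h => ?_, fun h => ?_, fun h => ?_, fun h => ?_, fun h => ?_⟩
  · rw [lin_eq]
    have hn := norm_nonneg h
    refine (abs_add_le _ _).trans ?_
    have h1 := one_mul_le (hf1 x) (hg.lin h)
    have h2 := one_mul_le (hg1 x) (hf.lin h)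
    nlinarith [mul_le_mul_of_nonneg_right hBB hn, mul_le_mul_of_nonneg_right hBB' hn]
  · rw [quad_eq]
    have hn := sq_nonneg ‖h‖
    refine (abs_add_three _ _ _).trans ?_
    have h1 := one_mul_le (hf1 x) (hg.quad h)
    have h2 := one_mul_le (hg1 x) (hf.quad h)
    have h3 := two_le (hf.lin h) (hg.lin h)
    nlinarith [mul_le_mul_of_nonneg_right hBB hn, mul_le_mul_of_nonneg_right hBB' hn]
  · have hn := norm_nonneg h
    have e : f (x + h) * g (x + h) - f x * g x
        = g (x + h) * (f (x + h) - f x) + f x * (g (x + h) - g x) := by ring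
    rw [e]
    refine (abs_add_le _ _).trans ?_
    have h1 := one_mul_le (hg1 (x + h)) (hf.zero h)
    have h2 := one_mul_le (hf1 x) (hg.zero h)
    nlinarith [mul_le_mul_of_nonneg_right hBB hn, mul_le_mul_of_nonneg_right hBB' hn]
  · have hn := sq_nonneg ‖h‖
    rw [lin_eq]
    have e : ∀ s s' : ℝ, f (x + h) * g (x + h) - f x * g x - (f x * s' + g x * s)
        = g (x + h) * (f (x + h) - f x - s) + f x * (g (x + h) - g x - s')
          + s * (g (x + h) - g x) := by intros; ring
    rw [e]
    refine (abs_add_three _ _ _).trans ?_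
    have h1 := one_mul_le (hg1 (x + h)) (hf.one h)
    have h2 := one_mul_le (hf1 x) (hg.one h)
    have h3 := two_le (hf.lin h) (hg.zero h)
    nlinarith [mul_le_mul_of_nonneg_right hBB hn, mul_le_mul_of_nonneg_right hBB' hn]
  · have hn := pow_nonneg (norm_nonneg h) 3
    rw [lin_eq, quad_eq]
    have e : ∀ s s' r r' : ℝ, f (x + h) * g (x + h) - f x * g x - (f x * s' + g x * s)
        - (f x * r' + g x * r + s * s')
        = g (x + h) * (f (x + h) - f x - s - r) + f x * (g (x + h) - g x - s' - r')
          + s * (g (x + h) - g x - s') + r * (g (x + h) - g x) := by intros; ring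
    rw [e]
    refine (abs_add_le _ _).trans ((add_le_add_left (abs_add_three _ _ _) _).trans ?_)
    have h1 := one_mul_le (hg1 (x + h)) (hf.two h)
    have h2 := one_mul_le (hf1 x) (hg.two h)
    have h3 := two_le (hf.lin h) (hg.one h)
    have h4 := two_le (hf.quad h) (hg.zero h)
    nlinarith [mul_le_mul_of_nonneg_right hBB hn, mul_le_mul_of_nonneg_right hBB' hn]

lemma norm_pow_three_le_sum {k : ℕ} (h : Fin k → ℝ) : ‖h‖ ^ 3 ≤ ∑ j, |h j| ^ 3 := by
  rcases isEmpty_or_nonempty (Fin k) with hk | hk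
  · simp [Subsingleton.elim h 0]
  · obtain ⟨j, hj⟩ := Finite.exists_max fun j => |h j|
    have : ‖h‖ ≤ |h j| := (pi_norm_le_iff_of_nonneg (abs_nonneg _)).2 hj
    calc ‖h‖ ^ 3 ≤ |h j| ^ 3 := by gcongr
      _ ≤ _ := Finset.single_le_sum (f := fun j => |h j| ^ 3) (fun i _ => by positivity)
        (Finset.mem_univ j)

/-! ### The smooth test functions -/

/-- Smooth approximation of `chi`. -/
noncomputable def softChi {k : ℕ} (l : ℝ) (x : Fin k → ℝ) : ℝ := ∏ j, softClip l (x j)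

/-- Smooth approximation of `zeta`. -/
noncomputable def softZeta {k : ℕ} (l : ℝ) (x : Fin k → ℝ) : ℝ := ∑ j, softSqDist l (x j)

lemma continuous_softChi {k : ℕ} {l : ℝ} : Continuous (softChi (k := k) l) :=
  continuous_finsetProd _ fun j _ => continuous_softClip.comp (continuous_apply j)

lemma continuous_softZeta {k : ℕ} {l : ℝ} : Continuous (softZeta (k := k) l) :=
  continuous_finsetSum _ fun j _ => continuous_softSqDist.comp (continuous_apply j)

/-- `softAbs l` is 1-Lipschitz, so its values at `x` and `x - 1` differ by at most one. -/
lemma abs_softClip_le_one {l : ℝ} (hl : 0 < l) (x : ℝ) : |softClip l x| ≤ 1 := by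
  have h := taylor_one (hasDerivAt_softAbs hl) (abs_div_softAbs_le hl) x (-1)
  rw [abs_neg, abs_one, mul_one, ← sub_eq_add_neg, abs_le] at h
  rw [softClip, abs_le]
  constructor <;> linarith [h.1, h.2]

lemma abs_prod_le_one {ι : Type*} (s : Finset ι) (f : ι → ℝ) (hf : ∀ i, |f i| ≤ 1) :
    |∏ i ∈ s, f i| ≤ 1 := by
  rw [Finset.abs_prod]
  exact Finset.prod_le_one (fun i _ => abs_nonneg _) fun i _ => hf i

lemma abs_prod_sub_prod_le {ι : Type*} (s : Finset ι) (f g : ι → ℝ) (hf : ∀ i, |f i| ≤ 1)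
    (hg : ∀ i, |g i| ≤ 1) : |∏ i ∈ s, f i - ∏ i ∈ s, g i| ≤ ∑ i ∈ s, |f i - g i| := by
  classical
  induction s using Finset.induction_on with
  | empty => simp
  | insert i s hi ih =>
    rw [Finset.prod_insert hi, Finset.prod_insert hi, Finset.sum_insert hi]
    have e : f i * ∏ i ∈ s, f i - g i * ∏ i ∈ s, g i
      = (f i - g i) * ∏ i ∈ s, f i + g i * (∏ i ∈ s, f i - ∏ i ∈ s, g i) := by ring
    rw [e]
    refine (abs_add_le _ _).trans (add_le_add ?_ ?_)
    · rw [abs_mul]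
      exact mul_le_of_le_one_right (abs_nonneg _) (abs_prod_le_one s f hf)
    · rw [abs_mul]
      exact (mul_le_of_le_one_left (abs_nonneg _) (hg i)).trans ih

lemma taylorAt_prod_softClip {k : ℕ} {l : ℝ} (hl : 0 < l) (hl1 : l ≤ 1) (s : Finset (Fin k))
    (x : Fin k → ℝ) : ∃ a q, TaylorAt (fun y => ∏ j ∈ s, softClip l (y j)) x
      ((12 / l ^ 2) ^ s.card) a q := by
  classical
  have hB : (1 : ℝ) ≤ 3 / l ^ 2 := by rw [le_div_iff₀ (by positivity)]; nlinarith
  have hB' : (1 : ℝ) ≤ 12 / l ^ 2 := by rw [le_div_iff₀ (by positivity)]; nlinarith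
  induction s using Finset.induction_on with
  | empty =>
    refine ⟨0, 0, ⟨?_, ?_, ?_, ?_, ?_⟩⟩ <;> intro h <;> simp
  | insert i s hi ih =>
    obtain ⟨a, q, hs⟩ := ih
    obtain ⟨b, c, hb, hc, hh⟩ := softClip_taylor hl hl1 (x i)
    have hn : ∀ h : Fin k → ℝ, |h i| ≤ ‖h‖ := fun h => norm_le_pi_norm h i
    have e1 : ∀ h : Fin k → ℝ, ∑ j, (Pi.single i b : Fin k → ℝ) j * h j = b * h i := by
      intro h
      rw [Finset.sum_eq_single i (fun j _ hj => by simp [hj]) (by simp)]; simp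
    have e2 : ∀ h : Fin k → ℝ, ∑ j, ∑ m, (Pi.single i (Pi.single i c) : Fin k → Fin k → ℝ) j m
        * (h j * h m) = c * h i ^ 2 := by
      intro h
      rw [Finset.sum_eq_single i (fun j _ hj => by simp [hj]) (by simp)]
      rw [Finset.sum_eq_single i (fun j _ hj => by simp [hj]) (by simp)]; simp [sq]
    have h1 : TaylorAt (fun y : Fin k → ℝ => softClip l (y i)) x (3 / l ^ 2)
        (Pi.single i b) (Pi.single i (Pi.single i c)) := by
      refine ⟨fun h => ?_, fun h => ?_, fun h => ?_, fun h => ?_, fun h => ?_⟩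
      · rw [e1, abs_mul]; exact mul_le_mul hb (hn h) (abs_nonneg _) (by positivity)
      · rw [e2, abs_mul, abs_pow]
        exact mul_le_mul hc (pow_le_pow_left₀ (abs_nonneg _) (hn h) 2) (by positivity)
          (by positivity)
      · exact (hh (h i)).1.trans (by gcongr; exact hn h)
      · rw [e1]; exact (hh (h i)).2.1.trans (by gcongr; exact hn h)
      · rw [e1, e2]; exact (hh (h i)).2.2.trans (by gcongr; exact hn h)
    have := h1.mul hs (fun y => abs_softClip_le_one hl _)
      (fun y => abs_prod_le_one s _ fun j => abs_softClip_le_one hl _) hB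
      (one_le_pow₀ hB')
    -- Each new factor costs its own Taylor constant `3 / l ^ 2` times the 4 of `TaylorAt.mul`.
    have eB : (12 / l ^ 2) ^ (s.card + 1) = 4 * (3 / l ^ 2) * (12 / l ^ 2) ^ s.card := by
      rw [pow_succ]; ring
    simp only [Finset.prod_insert hi, Finset.card_insert_of_notMem hi, eB]
    exact ⟨_, _, this⟩

lemma softChi_taylor {k : ℕ} {l : ℝ} (hl : 0 < l) (hl1 : l ≤ 1) :
    HasCubicTaylor (softChi (k := k) l) ((12 / l ^ 2) ^ k) := by
  intro x
  obtain ⟨a, q, h⟩ := taylorAt_prod_softClip hl hl1 Finset.univ x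
  refine ⟨a, q, fun y => (h.two y).trans ?_⟩
  rw [Finset.card_univ, Fintype.card_fin]
  gcongr
  exact norm_pow_three_le_sum y

lemma softZeta_taylor {k : ℕ} {l : ℝ} (hl : 0 < l) :
    HasCubicTaylor (softZeta (k := k) l) (6 / l) := by
  intro x
  choose a b h using fun j => softSqDist_taylor hl (x j)
  refine ⟨a, fun j => Pi.single j (b j), fun y => ?_⟩
  have e : ∀ j, ∑ m, (Pi.single j (b j) : Fin k → ℝ) m * (y j * y m) = b j * y j ^ 2 := by
    intro j
    rw [Finset.sum_eq_single j (fun m _ hm => by simp [hm]) (by simp)]; simp [sq]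
  simp only [e, softZeta, Pi.add_apply]
  rw [← Finset.sum_sub_distrib, ← Finset.sum_sub_distrib, ← Finset.sum_sub_distrib, Finset.mul_sum]
  exact (Finset.abs_sum_le_sum_abs _ _).trans (Finset.sum_le_sum fun j _ => h j (y j))

lemma abs_softChi_sub_chi_le {k : ℕ} {l : ℝ} (hl : 0 < l) (x : Fin k → ℝ) :
    |softChi l x - chi x| ≤ k * l := by
  refine (abs_prod_sub_prod_le _ _ _ (fun i => abs_softClip_le_one hl _) fun i => ?_).trans ?_
  · rw [abs_of_nonneg (clip_nonneg _)]; exact clip_le_one _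
  · refine (Finset.sum_le_sum fun j _ => abs_softClip_sub_clip_le hl (x j)).trans ?_
    simp

lemma abs_softZeta_sub_zeta_le {k : ℕ} {l : ℝ} (hl : 0 < l) (x : Fin k → ℝ) :
    |softZeta l x - zeta x| ≤ k * l ^ 2 := by
  rw [softZeta, zeta, ← Finset.sum_sub_distrib]
  refine (Finset.abs_sum_le_sum_abs _ _).trans
    ((Finset.sum_le_sum fun j _ => abs_softSqDist_sub_le hl (x j)).trans ?_)
  simp

lemma abs_chi_sub_chi_le {k : ℕ} (x y : Fin k → ℝ) : |chi x - chi y| ≤ ∑ j, |x j - y j| := by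
  refine (abs_prod_sub_prod_le _ _ _ (fun i => ?_) fun i => ?_).trans
    (Finset.sum_le_sum fun j _ => abs_clip_sub_clip_le _ _)
  all_goals rw [abs_of_nonneg (clip_nonneg _)]; exact clip_le_one _

lemma chi_nonneg {k : ℕ} (x : Fin k → ℝ) : 0 ≤ chi x :=
  Finset.prod_nonneg fun _ _ => clip_nonneg _

lemma chi_le_one {k : ℕ} (x : Fin k → ℝ) : chi x ≤ 1 :=
  Finset.prod_le_one (fun _ _ => clip_nonneg _) fun _ _ => clip_le_one _

lemma continuous_chi {k : ℕ} : Continuous (chi (k := k)) :=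
  continuous_finsetProd _ fun j _ => continuous_clip.comp (continuous_apply j)

/-! ### Hypercontractive families -/

/-- The `(2, 3)`-hypercontractive inequality `‖∑ w_a c_a u_a‖₃ ≤ (∑ c_a²)^{1/2}` for a finite
family `u` of random variables with weights `w`. -/
def IsHC {A S : Type*} [Fintype A] [MeasurableSpace S] (P : Measure S) (u : A → S → ℝ)
    (w : A → ℝ) : Prop :=
  ∀ c : A → ℝ, eLpNorm (fun x => ∑ a, w a * c a * u a x) 3 P ≤ ENNReal.ofReal √(∑ a, c a ^ 2)

lemma eLpNorm_three_pow {S : Type*} [MeasurableSpace S] (P : Measure S) (f : S → ℝ) :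
    eLpNorm f 3 P ^ 3 = ∫⁻ x, ‖f x‖ₑ ^ 3 ∂P := by
  have := eLpNorm_nnreal_pow_eq_lintegral (f := f) (μ := P) (p := 3) (by norm_num)
  have h3 : ((3 : NNReal) : ℝ) = ((3 : ℕ) : ℝ) := by norm_num
  rw [h3] at this
  simpa only [ENNReal.rpow_natCast, ENNReal.coe_ofNat] using this

lemma eLpNorm_sq_three_halves {S : Type*} [MeasurableSpace S] (P : Measure S) (f : S → ℝ) :
    eLpNorm (fun x => f x ^ 2) (3 / 2) P = eLpNorm f 3 P ^ 2 := by
  have := eLpNorm_norm_rpow (p := 3 / 2) (μ := P) (q := 2) f (by norm_num)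
  have h3 : (3 / 2 : ℝ≥0∞) * ENNReal.ofReal 2 = 3 := by
    rw [ENNReal.ofReal_ofNat, ENNReal.div_mul_cancel (by norm_num) (by norm_num)]
  rw [h3] at this
  have e : (fun x => ‖f x‖ ^ (2 : ℝ)) = fun x => f x ^ 2 := by
    funext x; simp
  rw [e] at this
  rw [this, ← ENNReal.rpow_natCast]; norm_num

/-- For fixed `x`, the inequality for `u'` with coefficients `G b x` bounds the inner `L³` norm by
`H x = (∑ G_b²)^(1/2)`. Then `‖H‖₃² = ‖∑ G_b²‖_{3/2} ≤ ∑ ‖G_b‖₃²` by Minkowski, and the inequality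
for `u` bounds each summand. Orthogonality plays no role, which is why `IsHC` is phrased with sums
of squared coefficients. -/
lemma IsHC.prod {A A' S S' : Type*} [Fintype A] [Fintype A'] [MeasurableSpace S]
    [MeasurableSpace S'] {P : Measure S} {P' : Measure S'} [SFinite P] [SFinite P']
    {u : A → S → ℝ} {u' : A' → S' → ℝ} {w : A → ℝ} {w' : A' → ℝ}
    (h : IsHC P u w) (h' : IsHC P' u' w') (hu : ∀ a, Measurable (u a))
    (hu' : ∀ a, Measurable (u' a)) :
    IsHC (P.prod P') (fun (p : A × A') z => u p.1 z.1 * u' p.2 z.2) (fun p => w p.1 * w' p.2) := by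
  intro c
  set G : A' → S → ℝ := fun b x => ∑ a, w a * c (a, b) * u a x with hG
  have hGm : ∀ b, Measurable (G b) := fun b => by
    simp only [hG]; fun_prop
  set F : S × S' → ℝ := fun z => ∑ p : A × A', w p.1 * w' p.2 * c p * (u p.1 z.1 * u' p.2 z.2)
    with hF
  have hFm : Measurable F := by simp only [hF]; fun_prop
  have hFG : ∀ x y, F (x, y) = ∑ b, w' b * G b x * u' b y := by
    intro x y
    simp only [hF, hG, Fintype.sum_prod_type_right]
    refine Finset.sum_congr rfl fun b _ => ?_
    rw [Finset.mul_sum, Finset.sum_mul]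
    exact Finset.sum_congr rfl fun a _ => by ring
  set H : S → ℝ := fun x => √(∑ b, G b x ^ 2) with hH
  have step1 : eLpNorm F 3 (P.prod P') ^ 3 ≤ eLpNorm H 3 P ^ 3 := by
    rw [eLpNorm_three_pow, eLpNorm_three_pow, lintegral_prod _ (by fun_prop)]
    refine lintegral_mono fun x => ?_
    have := h' (fun b => G b x)
    rw [← eLpNorm_three_pow P' (fun y => F (x, y))]
    simp only [hFG]
    refine (pow_le_pow_left₀ zero_le this 3).trans ?_
    rw [← Real.enorm_of_nonneg (Real.sqrt_nonneg _)]
  have step2 : eLpNorm H 3 P ^ 2 ≤ ENNReal.ofReal √(∑ p, c p ^ 2) ^ 2 := by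
    rw [← eLpNorm_sq_three_halves]
    have e : (fun x => H x ^ 2) = ∑ b, fun x => G b x ^ 2 := by
      funext x
      rw [Finset.sum_apply]
      exact Real.sq_sqrt (Finset.sum_nonneg fun _ _ => sq_nonneg _)
    rw [e]
    refine (eLpNorm_sum_le (fun b _ => ((hGm b).pow_const 2).aestronglyMeasurable) ?_).trans ?_
    · rw [ENNReal.le_div_iff_mul_le (by norm_num) (by norm_num)]; norm_num
    · rw [← ENNReal.ofReal_pow (Real.sqrt_nonneg _),
        Real.sq_sqrt (Finset.sum_nonneg fun _ _ => sq_nonneg _), Fintype.sum_prod_type_right,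
        ENNReal.ofReal_sum_of_nonneg (fun b _ => Finset.sum_nonneg fun _ _ => sq_nonneg _)]
      refine Finset.sum_le_sum fun b _ => ?_
      rw [eLpNorm_sq_three_halves]
      refine (pow_le_pow_left₀ zero_le (h fun a => c (a, b)) 2).trans ?_
      rw [← ENNReal.ofReal_pow (Real.sqrt_nonneg _),
        Real.sq_sqrt (Finset.sum_nonneg fun _ _ => sq_nonneg _)]
  exact ((ENNReal.pow_le_pow_left_iff (by norm_num)).1 step1).trans
    ((ENNReal.pow_le_pow_left_iff (by norm_num)).1 step2)

lemma IsHC.reindex {A A' S S' : Type*} [Fintype A] [Fintype A'] [MeasurableSpace S]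
    [MeasurableSpace S'] {P : Measure S} {P' : Measure S'} {u : A → S → ℝ} {w : A → ℝ}
    (h : IsHC P u w) (hu : ∀ a, Measurable (u a)) (e : A' ≃ A) {f : S' → S}
    (hf : MeasurePreserving f P' P) :
    IsHC P' (fun a x => u (e a) (f x)) (fun a => w (e a)) := by
  intro c
  have := h (fun a => c (e.symm a))
  rw [← eLpNorm_comp_measurePreserving
    (Finset.measurable_sum _ fun a _ => (hu a).const_mul _).aestronglyMeasurable hf,
    ← e.sum_comp] at this
  simp only [Function.comp_def, ← e.sum_comp, Equiv.symm_apply_apply] at this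
  exact this

lemma IsHC.pi {n : ℕ} {A S : Fin n → Type*} [∀ i, Fintype (A i)] [∀ i, MeasurableSpace (S i)]
    {P : ∀ i, Measure (S i)} [∀ i, IsProbabilityMeasure (P i)] {u : ∀ i, A i → S i → ℝ}
    {w : ∀ i, A i → ℝ} (h : ∀ i, IsHC (P i) (u i) (w i)) (hu : ∀ i a, Measurable (u i a)) :
    IsHC (Measure.pi P) (fun (σ : ∀ i, A i) x => ∏ i, u i (σ i) (x i))
      (fun σ => ∏ i, w i (σ i)) := by
  induction n with
  | zero =>
    intro c
    simp only [Finset.univ_eq_empty, Finset.prod_empty, Finset.univ_unique, Finset.sum_singleton,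
      one_mul, mul_one, Real.sqrt_sq_eq_abs]
    rw [eLpNorm_const _ (by norm_num) (IsProbabilityMeasure.ne_zero _)]
    simp [Real.enorm_eq_ofReal_abs]
  | succ n ih =>
    have := ((h 0).prod (ih (fun i => h i.succ) (fun i => hu i.succ)) (hu 0) (fun σ => by
      fun_prop)).reindex (fun p => by fun_prop) (Fin.consEquiv A).symm
      (measurePreserving_piFinSuccAbove P 0)
    simp only [Fin.prod_univ_succ]
    exact this

/-! ### Laws of hypercontractive orthonormal ensembles -/

/-- The law of a hypercontractive orthonormal ensemble, as a measure on `ℝ^(m+1)`. -/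
structure IsEnsembleLaw {m : ℕ} (η : ℝ) (κ : Measure (Fin (m + 1) → ℝ)) : Prop where
  prob : IsProbabilityMeasure κ
  zero_ae : ∀ᵐ x ∂κ, x 0 = 1
  orth : ∀ r s, ∫ x, x r * x s ∂κ = if r = s then 1 else 0
  hc : IsHC κ (fun r x => x r) (fun r => if r = 0 then 1 else η)

/-- The coordinate functions, as a sequence of families of random variables. -/
def coordSeq {n : ℕ} (m : Fin n → ℕ) :
    ∀ i, Fin (m i + 1) → (∀ i, Fin (m i + 1) → ℝ) → ℝ := fun i r x => x i r

lemma pow_degree_eq_prod {n : ℕ} {m : Fin n → ℕ} (η : ℝ) (σ : MultiIndex m) :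
    η ^ σ.degree = ∏ i, if σ i = 0 then 1 else η := by
  rw [Finset.prod_ite]
  simp [MultiIndex.degree]

lemma degree_le {n : ℕ} {m : Fin n → ℕ} (σ : MultiIndex m) : σ.degree ≤ n :=
  (Finset.card_le_univ _).trans (by simp)

lemma measurable_apply_coordSeq {n : ℕ} {m : Fin n → ℕ} (Q : MultilinearPoly m) :
    Measurable (Q.apply (coordSeq m)) := by
  unfold MultilinearPoly.apply coordSeq
  fun_prop

lemma integral_abs_pow_three_le {S : Type*} [MeasurableSpace S] {P : Measure S} {f : S → ℝ}
    {M : ℝ} (hM : 0 ≤ M) (hf : AEStronglyMeasurable f P)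
    (h : eLpNorm f 3 P ≤ ENNReal.ofReal M) : ∫ x, |f x| ^ 3 ∂P ≤ M ^ 3 := by
  rw [integral_eq_lintegral_of_nonneg_ae (Filter.Eventually.of_forall fun x => by positivity)
    (by fun_prop)]
  refine ENNReal.toReal_le_of_le_ofReal (by positivity) ?_
  rw [ENNReal.ofReal_pow hM]
  refine le_trans (le_of_eq ?_) (pow_le_pow_left₀ zero_le h 3)
  rw [eLpNorm_three_pow]
  refine lintegral_congr fun x => ?_
  rw [ENNReal.ofReal_pow (abs_nonneg _), ← Real.enorm_eq_ofReal_abs]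

section Laws

variable {n : ℕ} {m : Fin n → ℕ} {η : ℝ} {κ : ∀ i, Measure (Fin (m i + 1) → ℝ)}

lemma isHC_pi (hκ : ∀ i, IsEnsembleLaw η (κ i)) :
    IsHC (Measure.pi κ) (fun (σ : MultiIndex m) x => ∏ i, x i (σ i)) (fun σ => η ^ σ.degree) := by
  have := fun i => (hκ i).prob
  have h := IsHC.pi (fun i => (hκ i).hc) (fun i a => measurable_pi_apply a)
  simpa only [pow_degree_eq_prod] using h

/-- Hypercontractivity is applied to the coefficients `η⁻¹ ^ |σ| * Q σ`, so that the weights cancel;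
bounded degree limits the loss to `η⁻¹ ^ d`. -/
lemma eLpNorm_apply_le (hκ : ∀ i, IsEnsembleLaw η (κ i)) (hη : 0 < η) (hη1 : η ≤ 1) {d : ℕ}
    (Q : MultilinearPoly m) (hQ : ∀ σ, d < σ.degree → Q σ = 0) :
    eLpNorm (Q.apply (coordSeq m)) 3 (Measure.pi κ)
      ≤ ENNReal.ofReal (η⁻¹ ^ d * √(∑ σ, Q σ ^ 2)) := by
  have h := isHC_pi hκ (fun σ => η⁻¹ ^ σ.degree * Q σ)
  have e : (fun x : ∀ i, Fin (m i + 1) → ℝ =>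
      ∑ σ : MultiIndex m, η ^ σ.degree * (η⁻¹ ^ σ.degree * Q σ) * ∏ i, x i (σ i))
      = Q.apply (coordSeq m) := by
    funext x
    refine Finset.sum_congr rfl fun σ _ => ?_
    rw [← mul_assoc, ← mul_pow, mul_inv_cancel₀ hη.ne', one_pow, one_mul]
    rfl
  rw [e] at h
  refine h.trans (ENNReal.ofReal_le_ofReal ?_)
  rw [Real.sqrt_le_left (by positivity), mul_pow,
    Real.sq_sqrt (Finset.sum_nonneg fun _ _ => sq_nonneg _), Finset.mul_sum]
  refine Finset.sum_le_sum fun σ _ => ?_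
  rcases lt_or_ge d σ.degree with hd | hd
  · simp [hQ σ hd]
  · rw [mul_pow]
    gcongr
    exact one_le_inv_iff₀.2 ⟨hη, hη1⟩

lemma memLp_apply (hκ : ∀ i, IsEnsembleLaw η (κ i)) (hη : 0 < η) (hη1 : η ≤ 1)
    (Q : MultilinearPoly m) : MemLp (Q.apply (coordSeq m)) 3 (Measure.pi κ) :=
  ⟨(measurable_apply_coordSeq Q).aestronglyMeasurable,
    (eLpNorm_apply_le hκ hη hη1 Q
      fun σ hσ => absurd (degree_le σ) (not_le.2 hσ)).trans_lt ENNReal.ofReal_lt_top⟩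

lemma integral_abs_apply_pow_three_le (hκ : ∀ i, IsEnsembleLaw η (κ i)) (hη : 0 < η)
    (hη1 : η ≤ 1) {d : ℕ} (Q : MultilinearPoly m) (hQ : ∀ σ, d < σ.degree → Q σ = 0) :
    ∫ x, |Q.apply (coordSeq m) x| ^ 3 ∂(Measure.pi κ) ≤ (η⁻¹ ^ d * √(∑ σ, Q σ ^ 2)) ^ 3 :=
  integral_abs_pow_three_le (by positivity)
    (measurable_apply_coordSeq Q).aestronglyMeasurable (eLpNorm_apply_le hκ hη hη1 Q hQ)

end Laws

lemma IsEnsembleLaw.memLp {m : ℕ} {η : ℝ} {κ : Measure (Fin (m + 1) → ℝ)}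
    (hκ : IsEnsembleLaw η κ) (hη : 0 < η) (r : Fin (m + 1)) : MemLp (fun x => x r) 3 κ := by
  refine ⟨(measurable_pi_apply r).aestronglyMeasurable, ?_⟩
  have h := hκ.hc (Pi.single r (if r = 0 then 1 else η)⁻¹)
  have e : (fun x : Fin (m + 1) → ℝ => ∑ a, (if a = 0 then 1 else η) *
      (Pi.single r (if r = 0 then 1 else η)⁻¹ : Fin (m + 1) → ℝ) a * x a) = fun x => x r := by
    funext x
    rw [Finset.sum_eq_single r (fun b _ hb => by simp [hb]) (by simp), Pi.single_eq_same,
      mul_inv_cancel₀ (by split_ifs <;> positivity), one_mul]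
  rw [e] at h
  exact h.trans_lt ENNReal.ofReal_lt_top

lemma IsEnsembleLaw.integral_coord {m : ℕ} {η : ℝ} {κ : Measure (Fin (m + 1) → ℝ)}
    (hκ : IsEnsembleLaw η κ) (r : Fin (m + 1)) : ∫ x, x r ∂κ = if r = 0 then 1 else 0 := by
  rw [← hκ.orth r 0]
  refine integral_congr_ae ?_
  filter_upwards [hκ.zero_ae] with x hx
  rw [hx, mul_one]

/-! ### Integrability of smooth functions of polynomials -/

lemma integrable_mul_of_memLp_three {S : Type*} [MeasurableSpace S] {P : Measure S}
    [IsFiniteMeasure P] {f g : S → ℝ} (hf : MemLp f 3 P) (hg : MemLp g 3 P) :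
    Integrable (fun x => f x * g x) P :=
  (hf.mono_exponent (p := 2) (by norm_num)).integrable_mul
    (hg.mono_exponent (p := 2) (by norm_num))

lemma integrable_taylor {S : Type*} [MeasurableSpace S] {P : Measure S} [IsProbabilityMeasure P]
    {k : ℕ} {R : Fin k → S → ℝ} (hR : ∀ j, MemLp (R j) 3 P) (a : Fin k → ℝ)
    (q : Fin k → Fin k → ℝ) :
    Integrable (fun ω => ∑ j, a j * R j ω) P ∧
    Integrable (fun ω => ∑ j, ∑ l, q j l * (R j ω * R l ω)) P ∧
    Integrable (fun ω => ∑ j, |R j ω| ^ 3) P := by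
  refine ⟨integrable_finsetSum _ fun j _ =>
      ((hR j).integrable (by norm_num)).const_mul _,
    integrable_finsetSum _ fun j _ => integrable_finsetSum _ fun l _ =>
      (integrable_mul_of_memLp_three (hR j) (hR l)).const_mul _,
    integrable_finsetSum _ fun j _ => ?_⟩
  simpa using (hR j).integrable_norm_pow (p := 3) (by norm_num)

/-- The Taylor estimate at the origin dominates `Ψ` by a polynomial of degree three, and third
moments are finite. -/
lemma HasCubicTaylor.integrable_comp {S : Type*} [MeasurableSpace S] {P : Measure S}
    [IsProbabilityMeasure P] {k : ℕ} {Ψ : (Fin k → ℝ) → ℝ} {B : ℝ} (hΨ : HasCubicTaylor Ψ B)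
    (hc : Continuous Ψ) {R : Fin k → S → ℝ} (hR : ∀ j, MemLp (R j) 3 P) :
    Integrable (fun ω => Ψ (fun j => R j ω)) P := by
  obtain ⟨a, q, h⟩ := hΨ 0
  obtain ⟨h1, h2, h3⟩ := integrable_taylor hR a q
  have hm : AEStronglyMeasurable (fun ω => Ψ (fun j => R j ω)) P :=
    hc.comp_aestronglyMeasurable
      (aemeasurable_pi_lambda _ fun j => (hR j).1.aemeasurable).aestronglyMeasurable
  have h0 : Integrable (fun ω => Ψ (fun j => R j ω) - Ψ 0 - ∑ j, a j * R j ω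
      - ∑ j, ∑ l, q j l * (R j ω * R l ω)) P :=
    (h3.const_mul B).mono' (((hm.sub aestronglyMeasurable_const).sub h1.1).sub h2.1)
      (Filter.Eventually.of_forall fun ω => by simpa using h fun j => R j ω)
  refine (((h0.add h2).add h1).add (integrable_const (Ψ 0))).congr
    (Filter.Eventually.of_forall fun ω => ?_)
  simp only [Pi.add_apply]
  ring

/-! ### Replacing one ensemble -/

/-- The heart of the Lindeberg step: `C` is chosen before `κ`. Expanding around the constant
coefficients `L j 0`, the linear terms have mean zero and the quadratic ones are determined by
orthonormality, so both are the same for every ensemble law. -/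
lemma exists_expansion {m k : ℕ} {η : ℝ} (hη : 0 < η) {Ψ : (Fin k → ℝ) → ℝ} {B : ℝ}
    (hΨ : HasCubicTaylor Ψ B) (hc : Continuous Ψ) (L : Fin k → Fin (m + 1) → ℝ) :
    ∃ C : ℝ, ∀ κ : Measure (Fin (m + 1) → ℝ), IsEnsembleLaw η κ →
      |∫ x, Ψ (fun j => ∑ r, x r * L j r) ∂κ - C| ≤
        B * ∫ x, ∑ j, |∑ r, x r * (if r = 0 then 0 else L j r)| ^ 3 ∂κ := by
  obtain ⟨a, q, h⟩ := hΨ fun j => L j 0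
  refine ⟨Ψ (fun j => L j 0) + ∑ j, ∑ l, q j l *
    ∑ r, (if r = 0 then 0 else L j r) * (if r = 0 then 0 else L l r), fun κ hκ => ?_⟩
  have := hκ.prob
  set L' : Fin k → Fin (m + 1) → ℝ := fun j r => if r = 0 then 0 else L j r with hL'
  have hlin : ∀ M : Fin (m + 1) → ℝ, MemLp (fun x => ∑ r, x r * M r) 3 κ := fun M =>
    memLp_finsetSum _ fun r _ => (hκ.memLp hη r).mul_const _
  obtain ⟨i1, i2, i3⟩ := integrable_taylor (fun j => hlin (L' j)) a q
  have i0 := hΨ.integrable_comp hc (fun j => hlin (L j))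
  have e1 : ∫ x, ∑ j, a j * ∑ r, x r * L' j r ∂κ = 0 := by
    rw [integral_finsetSum _ fun j _ => ((hlin (L' j)).integrable (by norm_num)).const_mul _]
    refine Finset.sum_eq_zero fun j _ => ?_
    rw [integral_const_mul, integral_finsetSum _ fun r _ =>
      ((hκ.memLp hη r).integrable (by norm_num)).mul_const _]
    rw [Finset.sum_eq_zero, mul_zero]
    intro r _
    rw [integral_mul_const, hκ.integral_coord]
    simp only [hL']
    split_ifs <;> simp
  have i2' : ∀ j l, Integrable (fun x => (∑ r, x r * L' j r) * ∑ r, x r * L' l r) κ := fun j l =>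
    integrable_mul_of_memLp_three (hlin (L' j)) (hlin (L' l))
  have i3' : ∀ r s, Integrable (fun x : Fin (m + 1) → ℝ => x r * x s) κ := fun r s =>
    integrable_mul_of_memLp_three (hκ.memLp hη r) (hκ.memLp hη s)
  have e2 : ∫ x, ∑ j, ∑ l, q j l * ((∑ r, x r * L' j r) * ∑ r, x r * L' l r) ∂κ
      = ∑ j, ∑ l, q j l * ∑ r, L' j r * L' l r := by
    rw [integral_finsetSum _ fun j _ => integrable_finsetSum _ fun l _ =>
      (i2' j l).const_mul _]
    refine Finset.sum_congr rfl fun j _ => ?_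
    rw [integral_finsetSum _ fun l _ => (i2' j l).const_mul _]
    refine Finset.sum_congr rfl fun l _ => ?_
    rw [integral_const_mul]
    congr 1
    have e : ∀ x : Fin (m + 1) → ℝ, (∑ r, x r * L' j r) * ∑ r, x r * L' l r
        = ∑ r, ∑ s, (x r * x s) * (L' j r * L' l s) := by
      intro x
      rw [Finset.sum_mul_sum]
      exact Finset.sum_congr rfl fun r _ => Finset.sum_congr rfl fun s _ => by ring
    simp only [e]
    rw [integral_finsetSum _ fun r _ => integrable_finsetSum _ fun s _ =>
      (i3' r s).mul_const _]
    refine Finset.sum_congr rfl fun r _ => ?_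
    rw [integral_finsetSum _ fun s _ => (i3' r s).mul_const _]
    simp only [integral_mul_const, hκ.orth]
    simp
  have key : ∫ x, Ψ (fun j => ∑ r, x r * L j r) ∂κ - (Ψ (fun j => L j 0) + ∑ j, ∑ l, q j l *
      ∑ r, L' j r * L' l r) = ∫ x, (Ψ (fun j => ∑ r, x r * L j r) - Ψ (fun j => L j 0)
        - ∑ j, a j * ∑ r, x r * L' j r
        - ∑ j, ∑ l, q j l * ((∑ r, x r * L' j r) * ∑ r, x r * L' l r)) ∂κ := by
    have j0 : Integrable (fun x => Ψ (fun j => ∑ r, x r * L j r) - Ψ (fun j => L j 0)) κ :=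
      i0.sub (integrable_const _)
    have j1 : Integrable (fun x => Ψ (fun j => ∑ r, x r * L j r) - Ψ (fun j => L j 0)
        - ∑ j, a j * ∑ r, x r * L' j r) κ := j0.sub i1
    rw [integral_sub j1 i2, integral_sub j0 i1, integral_sub i0 (integrable_const _), e1, e2]
    simp only [integral_const, probReal_univ, one_smul]
    ring
  rw [key, ← integral_const_mul]
  refine (abs_integral_le_integral_abs).trans (integral_mono_ae ?_ (i3.const_mul B) ?_)
  · exact (((i0.sub (integrable_const _)).sub i1).sub i2).abs
  -- Since `x 0 = 1` almost surely, the constant coefficient is the base point and the remaining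
  -- terms are the increment.
  · filter_upwards [hκ.zero_ae] with x hx
    have e : (fun j => ∑ r, x r * L j r) = (fun j => L j 0) + fun j => ∑ r, x r * L' j r := by
      funext j
      simp only [Pi.add_apply, hL', Fin.sum_univ_succ, hx]
      simp
    simpa only [e] using h fun j => ∑ r, x r * L' j r

/-! ### The replacement argument -/

/-- The part of `Q` that depends on the `i`-th ensemble. -/
def MultilinearPoly.partAt {n : ℕ} {m : Fin n → ℕ} (i : Fin n) (Q : MultilinearPoly m) :
    MultilinearPoly m := fun σ => if σ i = 0 then 0 else Q σ

/-- The coefficient of `x_{i,r}` in `Q`, a polynomial in the other ensembles. -/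
def MultilinearPoly.slice {n : ℕ} {m : Fin (n + 1) → ℕ} (i : Fin (n + 1))
    (Q : MultilinearPoly m) (r : Fin (m i + 1)) : MultilinearPoly (fun j => m (i.succAbove j)) :=
  fun ρ => Q (i.insertNth r ρ)

lemma apply_insertNth {n : ℕ} {m : Fin (n + 1) → ℕ} (i : Fin (n + 1)) (Q : MultilinearPoly m)
    (x : Fin (m i + 1) → ℝ) (y : ∀ j, Fin (m (i.succAbove j) + 1) → ℝ) :
    Q.apply (coordSeq m) (i.insertNth (α := fun i => Fin (m i + 1) → ℝ) x y)
      = ∑ r, x r * (Q.slice i r).apply (coordSeq fun j => m (i.succAbove j)) y := by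
  unfold MultilinearPoly.apply coordSeq MultilinearPoly.slice
  rw [← (Fin.insertNthEquiv (fun i => Fin (m i + 1)) i).sum_comp, Fintype.sum_prod_type]
  refine Finset.sum_congr rfl fun r _ => ?_
  rw [Finset.mul_sum]
  refine Finset.sum_congr rfl fun ρ _ => ?_
  rw [Fin.prod_univ_succAbove _ i]
  simp [Fin.insertNthEquiv]
  ring

lemma slice_partAt {n : ℕ} {m : Fin (n + 1) → ℕ} (i : Fin (n + 1)) (Q : MultilinearPoly m)
    (r : Fin (m i + 1)) (y : ∀ j, Fin (m (i.succAbove j) + 1) → ℝ) :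
    ((Q.partAt i).slice i r).apply (coordSeq fun j => m (i.succAbove j)) y
      = if r = 0 then 0 else (Q.slice i r).apply (coordSeq fun j => m (i.succAbove j)) y := by
  unfold MultilinearPoly.slice MultilinearPoly.partAt MultilinearPoly.apply
  split_ifs with h <;> simp [h]

lemma integral_pi_succAbove {n : ℕ} {E : Fin (n + 1) → Type*} [∀ i, MeasurableSpace (E i)]
    (κ : ∀ i, Measure (E i)) [∀ i, IsProbabilityMeasure (κ i)] (i : Fin (n + 1))
    {F : (∀ i, E i) → ℝ} (hF : Integrable F (Measure.pi κ)) :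
    Integrable (fun y => ∫ x, F (i.insertNth x y) ∂(κ i)) (Measure.pi fun j => κ (i.succAbove j)) ∧
    ∫ z, F z ∂(Measure.pi κ)
      = ∫ y, ∫ x, F (i.insertNth x y) ∂(κ i) ∂(Measure.pi fun j => κ (i.succAbove j)) := by
  have hmp := (measurePreserving_piFinSuccAbove κ i).symm
  have hF' := (hmp.integrable_comp_emb (MeasurableEquiv.measurableEmbedding _)).2 hF
  refine ⟨hF'.integral_prod_right, ?_⟩
  rw [← hmp.integral_comp (MeasurableEquiv.measurableEmbedding _)]
  exact integral_prod_symm _ hF'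

section Replacement

variable {n k : ℕ} {m : Fin n → ℕ} {η : ℝ} {Ψ : (Fin k → ℝ) → ℝ} {B : ℝ}

/-- By Fubini the other coordinates can be frozen. Then each `Q j` is linear in the `i`-th block,
with the slices as coefficients, and the integrals over `κ i` and `ν` are both close to the same
constant from `exists_expansion`. -/
lemma replace_one (hη : 0 < η) (hη1 : η ≤ 1)
    (hΨ : HasCubicTaylor Ψ B) (hc : Continuous Ψ) (Q : Fin k → MultilinearPoly m)
    {κ : ∀ i, Measure (Fin (m i + 1) → ℝ)} (hκ : ∀ i, IsEnsembleLaw η (κ i)) (i : Fin n)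
    {ν : Measure (Fin (m i + 1) → ℝ)} (hν : IsEnsembleLaw η ν) :
    |∫ x, Ψ (fun j => (Q j).apply (coordSeq m) x) ∂(Measure.pi κ)
      - ∫ x, Ψ (fun j => (Q j).apply (coordSeq m) x) ∂(Measure.pi (Function.update κ i ν))| ≤
    B * (∫ x, ∑ j, |((Q j).partAt i).apply (coordSeq m) x| ^ 3 ∂(Measure.pi κ) +
      ∫ x, ∑ j, |((Q j).partAt i).apply (coordSeq m) x| ^ 3
        ∂(Measure.pi (Function.update κ i ν))) := by
  obtain _ | n := n
  · exact i.elim0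
  set κ' := Function.update κ i ν with hκ'
  have hgood : ∀ j, IsEnsembleLaw η (κ' j) := by
    intro j
    rcases eq_or_ne j i with rfl | hj
    · rw [hκ', Function.update_self]; exact hν
    · rw [hκ', Function.update_of_ne hj]; exact hκ j
  have e1 : κ' i = ν := Function.update_self _ _ _
  have e2 : ∀ j, κ' (i.succAbove j) = κ (i.succAbove j) := fun j =>
    Function.update_of_ne (Fin.succAbove_ne i j) _ _
  have p1 := fun i => (hκ i).prob
  have p2 := fun i => (hgood i).prob
  have hint := hΨ.integrable_comp hc (fun j => memLp_apply hκ hη hη1 (Q j))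
  have hint' := hΨ.integrable_comp hc (fun j => memLp_apply hgood hη hη1 (Q j))
  have hint3 := (integrable_taylor (fun j => memLp_apply hκ hη hη1 ((Q j).partAt i)) 0 0).2.2
  have hint3' := (integrable_taylor (fun j => memLp_apply hgood hη hη1 ((Q j).partAt i)) 0 0).2.2
  obtain ⟨a1, b1⟩ := integral_pi_succAbove κ i hint
  obtain ⟨a2, b2⟩ := integral_pi_succAbove κ' i hint'
  obtain ⟨a3, b3⟩ := integral_pi_succAbove κ i hint3
  obtain ⟨a4, b4⟩ := integral_pi_succAbove κ' i hint3'
  simp only [e1, e2] at a2 a4 b2 b4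
  rw [b1, b2, b3, b4, ← integral_sub a1 a2, ← integral_add a3 a4, ← integral_const_mul]
  refine abs_integral_le_integral_abs.trans (integral_mono (a1.sub a2).abs
    ((a3.add a4).const_mul B) fun y => ?_)
  simp only [apply_insertNth, slice_partAt]
  obtain ⟨C, hC⟩ := exists_expansion hη hΨ hc
    (fun j r => ((Q j).slice i r).apply (coordSeq fun j => m (i.succAbove j)) y)
  have c1 := hC (κ i) (hκ i)
  have c2 := hC ν hν
  rw [abs_sub_comm] at c2
  rw [mul_add]
  refine le_trans ?_ (add_le_add c1 c2)
  refine le_trans (le_of_eq ?_) (abs_add_le _ _)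
  congr 1
  ring

/-- The hybrids are product measures that use `ν` on a set `s` and `ξ` elsewhere. Working with laws
on `ℝ^(m+1)` makes such mixtures available even if the sequences live on different spaces. Every
hybrid obeys the same third moment bound. -/
lemma replace_all (hη : 0 < η) (hη1 : η ≤ 1) (hB : 0 ≤ B)
    (hΨ : HasCubicTaylor Ψ B) (hc : Continuous Ψ) (Q : Fin k → MultilinearPoly m) {d : ℕ}
    (hQ : ∀ j σ, d < σ.degree → Q j σ = 0)
    {ξ ν : ∀ i, Measure (Fin (m i + 1) → ℝ)} (hξ : ∀ i, IsEnsembleLaw η (ξ i))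
    (hν : ∀ i, IsEnsembleLaw η (ν i)) :
    |∫ x, Ψ (fun j => (Q j).apply (coordSeq m) x) ∂(Measure.pi ξ)
      - ∫ x, Ψ (fun j => (Q j).apply (coordSeq m) x) ∂(Measure.pi ν)| ≤
    2 * B * (η⁻¹ ^ d) ^ 3 * ∑ i, ∑ j, √(∑ σ, (Q j).partAt i σ ^ 2) ^ 3 := by
  classical
  have main : ∀ s : Finset (Fin n), |∫ x, Ψ (fun j => (Q j).apply (coordSeq m) x) ∂(Measure.pi ξ)
      - ∫ x, Ψ (fun j => (Q j).apply (coordSeq m) x) ∂(Measure.pi (s.piecewise ν ξ))| ≤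
    ∑ i ∈ s, 2 * B * (η⁻¹ ^ d) ^ 3 * ∑ j, √(∑ σ, (Q j).partAt i σ ^ 2) ^ 3 := by
    intro s
    have hs : ∀ (s : Finset (Fin n)) i, IsEnsembleLaw η (s.piecewise ν ξ i) := by
      intro s i
      by_cases h : i ∈ s
      · rw [Finset.piecewise_eq_of_mem _ _ _ h]; exact hν i
      · rw [Finset.piecewise_eq_of_notMem _ _ _ h]; exact hξ i
    induction s using Finset.induction_on with
    | empty => simp
    | insert i s hi ih =>
      rw [Finset.sum_insert hi, add_comm]
      have step := replace_one hη hη1 hΨ hc Q (hs s) i (hν i)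
      rw [← Finset.piecewise_insert] at step
      have bd : ∀ s : Finset (Fin n), ∫ x, ∑ j, |((Q j).partAt i).apply (coordSeq m) x| ^ 3
          ∂(Measure.pi (s.piecewise ν ξ))
          ≤ (η⁻¹ ^ d) ^ 3 * ∑ j, √(∑ σ, (Q j).partAt i σ ^ 2) ^ 3 := by
        intro s
        have := fun i => (hs s i).prob
        rw [integral_finsetSum _ fun j _ => by
          simpa using (memLp_apply (hs s) hη hη1 ((Q j).partAt i)).integrable_norm_pow
            (p := 3) (by norm_num), Finset.mul_sum]
        refine Finset.sum_le_sum fun j _ => ?_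
        rw [← mul_pow]
        refine integral_abs_apply_pow_three_le (hs s) hη hη1 _ fun σ hσ => ?_
        simp [MultilinearPoly.partAt, hQ j σ hσ]
      refine (abs_sub_le _ _ _).trans (add_le_add ih (step.trans ?_))
      calc _ ≤ B * ((η⁻¹ ^ d) ^ 3 * ∑ j, √(∑ σ, (Q j).partAt i σ ^ 2) ^ 3
            + (η⁻¹ ^ d) ^ 3 * ∑ j, √(∑ σ, (Q j).partAt i σ ^ 2) ^ 3) := by
              gcongr
              · exact bd s
              · exact bd (insert i s)
        _ = _ := by ring
  have := main Finset.univ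
  rw [Finset.piecewise_univ] at this
  rwa [Finset.mul_sum]

end Replacement

lemma sum_partAt_sq {n : ℕ} {m : Fin n → ℕ} (Q : MultilinearPoly m) :
    ∑ i, ∑ σ, Q.partAt i σ ^ 2 = ∑ σ : MultiIndex m, (σ.degree : ℝ) * Q σ ^ 2 := by
  rw [Finset.sum_comm]
  refine Finset.sum_congr rfl fun σ _ => ?_
  simp only [MultilinearPoly.partAt, MultiIndex.degree, Finset.card_filter, ite_pow]
  push_cast
  rw [Finset.sum_mul]
  refine Finset.sum_congr rfl fun i _ => ?_
  by_cases h : σ i = 0 <;> simp [h]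

/-- The total error of the replacement argument for polynomials of degree at most `d` with
influences at most `τ`. -/
lemma sum_sqrt_partAt_le {n k : ℕ} {m : Fin n → ℕ} (Q : Fin k → MultilinearPoly m) {d : ℕ}
    {τ : ℝ} (hQ : ∀ j σ, d < σ.degree → Q j σ = 0)
    (hτ : ∀ i, ∑ j, ∑ σ, (Q j).partAt i σ ^ 2 ≤ τ)
    (hv : ∑ j, ∑ σ, (if σ.degree = 0 then 0 else Q j σ ^ 2) ≤ 1) :
    ∑ i, ∑ j, √(∑ σ, (Q j).partAt i σ ^ 2) ^ 3 ≤ √τ * d := by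
  calc ∑ i, ∑ j, √(∑ σ, (Q j).partAt i σ ^ 2) ^ 3
      ≤ ∑ i, ∑ j, √τ * ∑ σ, (Q j).partAt i σ ^ 2 := by
        refine Finset.sum_le_sum fun i _ => Finset.sum_le_sum fun j _ => ?_
        have h0 : ∀ j, 0 ≤ ∑ σ, (Q j).partAt i σ ^ 2 := fun j =>
          Finset.sum_nonneg fun _ _ => sq_nonneg _
        -- This is `t^(3/2) ≤ √τ * t` for `0 ≤ t ≤ τ`.
        rw [pow_succ', Real.sq_sqrt (h0 j)]
        gcongr
        exact (Finset.single_le_sum (fun j _ => h0 j) (Finset.mem_univ j)).trans (hτ i)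
    _ = √τ * ∑ j, ∑ i, ∑ σ, (Q j).partAt i σ ^ 2 := by
        rw [Finset.sum_comm]; simp only [Finset.mul_sum]
    _ ≤ √τ * ∑ j, ∑ σ, d * (if σ.degree = 0 then 0 else Q j σ ^ 2) := by
        gcongr with j
        rw [sum_partAt_sq]
        refine Finset.sum_le_sum fun σ _ => ?_
        split_ifs with h0
        · simp [h0]
        rcases lt_or_ge d σ.degree with h | h
        · simp [hQ j σ h]
        · gcongr
    _ ≤ √τ * d := by
        simp only [← Finset.mul_sum]
        gcongr
        exact mul_le_of_le_one_right (Nat.cast_nonneg _) hv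

/-! ### Orthonormality of the monomials -/

section Ensembles

variable {S : Type*} [MeasurableSpace S] {P : Measure S} [IsProbabilityMeasure P]
  {n : ℕ} {m : Fin n → ℕ} {Z : ∀ i, Fin (m i + 1) → S → ℝ}

lemma degree_eq_zero_iff {σ : MultiIndex m} : σ.degree = 0 ↔ σ = 0 := by
  rw [MultiIndex.degree, Finset.card_eq_zero, Finset.filter_eq_empty_iff]
  simp [funext_iff]

omit [IsProbabilityMeasure P] in
lemma IsEnsembleSeq.measurable_family (hZ : IsEnsembleSeq P Z) (i : Fin n) :
    Measurable fun ω r => Z i r ω :=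
  measurable_pi_lambda _ fun r => (hZ.ensemble i).measurable r

omit [IsProbabilityMeasure P] in
lemma IsEnsembleSeq.measurePreserving (hZ : IsEnsembleSeq P Z) :
    MeasurePreserving (fun ω i r => Z i r ω) P
      (Measure.pi fun i => P.map fun ω r => Z i r ω) :=
  ⟨measurable_pi_lambda _ hZ.measurable_family,
    hZ.indep.map_fun_eq_pi_map fun i => (hZ.measurable_family i).aemeasurable⟩

omit [IsProbabilityMeasure P] in
lemma IsEnsembleSeq.measurable_apply (hZ : IsEnsembleSeq P Z) (Q : MultilinearPoly m) :
    Measurable (Q.apply Z) := by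
  have := fun i r => (hZ.ensemble i).measurable r
  unfold MultilinearPoly.apply
  fun_prop

lemma IsEnsembleSeq.integrable_monomial_mul (hZ : IsEnsembleSeq P Z) (σ ρ : MultiIndex m) :
    Integrable (fun ω => (∏ i, Z i (σ i) ω) * ∏ i, Z i (ρ i) ω) P := by
  simp only [← Finset.prod_mul_distrib]
  have := fun i => Measure.isProbabilityMeasure_map (μ := P) (hZ.measurable_family i).aemeasurable
  have h : ∀ i, Integrable (fun x : Fin (m i + 1) → ℝ => x (σ i) * x (ρ i))
      (P.map fun ω r => Z i r ω) := fun i => by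
    rw [integrable_map_measure (by fun_prop) (hZ.measurable_family i).aemeasurable]
    exact ((hZ.ensemble i).memLp _).integrable_mul ((hZ.ensemble i).memLp _)
  exact hZ.measurePreserving.integrable_comp_of_integrable (Integrable.fintype_prod_dep h)

omit [IsProbabilityMeasure P] in
lemma IsEnsembleSeq.integral_monomial_mul (hZ : IsEnsembleSeq P Z) (σ ρ : MultiIndex m) :
    ∫ ω, (∏ i, Z i (σ i) ω) * ∏ i, Z i (ρ i) ω ∂P = if σ = ρ then 1 else 0 := by
  simp only [← Finset.prod_mul_distrib]
  have := hZ.indep.integral_fun_prod_comp (f := fun i x => x (σ i) * x (ρ i))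
    (fun i => (hZ.measurable_family i).aemeasurable)
    (fun i => by fun_prop)
  rw [this]
  simp only [(hZ.ensemble _).orthonormal]
  rw [Finset.prod_ite_zero]
  simp [funext_iff]

omit [IsProbabilityMeasure P] in
lemma IsEnsembleSeq.monomial_zero (hZ : IsEnsembleSeq P Z) (ω : S) :
    ∏ i, Z i ((0 : MultiIndex m) i) ω = 1 :=
  Finset.prod_eq_one fun i _ => (hZ.ensemble i).zero_eq_one ω

lemma IsEnsembleSeq.memLp_apply (hZ : IsEnsembleSeq P Z) (Q : MultilinearPoly m) :
    MemLp (Q.apply Z) 2 P := by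
  refine memLp_finsetSum _ fun σ _ => MemLp.const_mul ?_ _
  have hm : Measurable fun ω => ∏ i, Z i (σ i) ω := by
    have := fun i r => (hZ.ensemble i).measurable r
    fun_prop
  rw [memLp_two_iff_integrable_sq hm.aestronglyMeasurable]
  simpa only [sq] using hZ.integrable_monomial_mul σ σ

lemma IsEnsembleSeq.integral_apply (hZ : IsEnsembleSeq P Z) (Q : MultilinearPoly m) :
    ∫ ω, Q.apply Z ω ∂P = Q 0 := by
  have h1 : ∀ σ : MultiIndex m, Integrable (fun ω => ∏ i, Z i (σ i) ω) P := fun σ => by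
    simpa only [hZ.monomial_zero, mul_one] using hZ.integrable_monomial_mul σ 0
  have h2 : ∀ σ : MultiIndex m, ∫ ω, ∏ i, Z i (σ i) ω ∂P = if σ = 0 then 1 else 0 := fun σ => by
    simpa only [hZ.monomial_zero, mul_one] using hZ.integral_monomial_mul σ 0
  unfold MultilinearPoly.apply
  rw [integral_finsetSum _ fun σ _ => (h1 σ).const_mul _]
  simp [integral_const_mul, h2]

lemma IsEnsembleSeq.integral_apply_sq (hZ : IsEnsembleSeq P Z) (Q : MultilinearPoly m) :
    ∫ ω, Q.apply Z ω ^ 2 ∂P = ∑ σ, Q σ ^ 2 := by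
  have e : ∀ ω, Q.apply Z ω ^ 2 = ∑ σ, ∑ ρ, Q σ * Q ρ *
      ((∏ i, Z i (σ i) ω) * ∏ i, Z i (ρ i) ω) := by
    intro ω
    rw [sq, MultilinearPoly.apply, Finset.sum_mul_sum]
    exact Finset.sum_congr rfl fun σ _ => Finset.sum_congr rfl fun ρ _ => by ring
  simp only [e]
  rw [integral_finsetSum _ fun σ _ => integrable_finsetSum _ fun ρ _ =>
    (hZ.integrable_monomial_mul σ ρ).const_mul _]
  refine Finset.sum_congr rfl fun σ _ => ?_
  rw [integral_finsetSum _ fun ρ _ => (hZ.integrable_monomial_mul σ ρ).const_mul _]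
  simp [integral_const_mul, hZ.integral_monomial_mul, sq]

/-- The sum of the squares of the coefficients of degree larger than zero. -/
def coeffVar (Q : MultilinearPoly m) : ℝ := ∑ σ, if σ.degree = 0 then 0 else Q σ ^ 2

lemma coeffVar_nonneg (Q : MultilinearPoly m) : 0 ≤ coeffVar Q :=
  Finset.sum_nonneg fun σ _ => by positivity

lemma IsEnsembleSeq.integral_sub_sq (hZ : IsEnsembleSeq P Z) (Q : MultilinearPoly m) :
    ∫ ω, (Q.apply Z ω - Q 0) ^ 2 ∂P = coeffVar Q := by
  have e : ∀ ω, Q.apply Z ω - Q 0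
      = MultilinearPoly.apply (fun σ => if σ.degree = 0 then 0 else Q σ) Z ω := by
    intro ω
    have h0 : Q 0 = ∑ σ : MultiIndex m, (if σ = 0 then Q σ else 0) * ∏ i, Z i (σ i) ω := by
      rw [Finset.sum_eq_single 0 (fun b _ hb => by simp [hb]) (by simp), hZ.monomial_zero]
      simp
    rw [h0, MultilinearPoly.apply, MultilinearPoly.apply, ← Finset.sum_sub_distrib]
    refine Finset.sum_congr rfl fun σ _ => ?_
    simp only [degree_eq_zero_iff]
    split_ifs <;> ring
  simp only [e, hZ.integral_apply_sq, coeffVar, ite_pow]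
  simp

lemma IsEnsembleSeq.variance_apply (hZ : IsEnsembleSeq P Z) (Q : MultilinearPoly m) :
    variance (Q.apply Z) P = coeffVar Q := by
  rw [variance_eq_integral (hZ.measurable_apply Q).aemeasurable, hZ.integral_apply,
    hZ.integral_sub_sq]

lemma vecVariance_eq_sum {k : ℕ} {F : Fin k → S → ℝ} (hF : ∀ j, MemLp (F j) 2 P) :
    vecVariance P F = ∑ j, variance (F j) P := by
  have hi : ∀ j, Integrable (fun ω => (F j ω - ∫ ω', F j ω' ∂P) ^ 2) P := fun j =>
    ((hF j).sub (memLp_const (∫ ω', F j ω' ∂P))).integrable_sq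
  rw [vecVariance, integral_finsetSum _ fun j _ => hi j]
  exact Finset.sum_congr rfl fun j _ => (variance_eq_integral (hF j).1.aemeasurable).symm

end Ensembles

/-! ### Hypercontractivity of the given ensembles -/

/-- A sequence of ensembles each of which is hypercontractive. -/
structure IsHCSeq {S : Type*} [MeasurableSpace S] (η : ℝ) (P : Measure S) {n : ℕ} {m : Fin n → ℕ}
    (Z : ∀ i, Fin (m i + 1) → S → ℝ) : Prop where
  seq : IsEnsembleSeq P Z
  hc : ∀ i, IsHC P (Z i) (fun r => if r = 0 then 1 else η)

section HC

variable {S : Type*} [MeasurableSpace S] {P : Measure S} [IsProbabilityMeasure P]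
  {n : ℕ} {m : Fin n → ℕ} {Z : ∀ i, Fin (m i + 1) → S → ℝ} {η : ℝ}

lemma IsHCSeq.isEnsembleLaw (hZ : IsHCSeq η P Z) (i : Fin n) :
    IsEnsembleLaw η (P.map fun ω r => Z i r ω) := by
  have hm := hZ.seq.measurable_family i
  refine ⟨Measure.isProbabilityMeasure_map hm.aemeasurable, ?_, fun r s => ?_, fun c => ?_⟩
  · rw [ae_map_iff hm.aemeasurable (measurableSet_eq_fun (by fun_prop) (by fun_prop))]
    exact Filter.Eventually.of_forall fun ω => (hZ.seq.ensemble i).zero_eq_one ω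
  · rw [integral_map hm.aemeasurable (by fun_prop)]
    exact (hZ.seq.ensemble i).orthonormal r s
  · rw [eLpNorm_map_measure (Measurable.aestronglyMeasurable (by dsimp only; fun_prop))
      hm.aemeasurable]
    exact hZ.hc i c

omit [IsProbabilityMeasure P] in
lemma eLpNorm_two_le {f : S → ℝ} (hf : MemLp f 2 P) :
    eLpNorm f 2 P = ENNReal.ofReal √(∫ ω, f ω ^ 2 ∂P) := by
  rw [hf.eLpNorm_eq_integral_rpow_norm (by norm_num) (by norm_num), Real.sqrt_eq_rpow]
  norm_num

/-- The hypothesis is tested on polynomials in the `i`-th ensemble alone. Their monomials are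
indexed by `Pi.single i r`, of degree 0 or 1, and orthonormality turns the `L²` norm into the
coefficient norm. -/
lemma IsEnsembleSeq.isHC_of_isHypercontractive (hZ : IsEnsembleSeq P Z)
    (h : IsHypercontractive P Z 2 3 η) (i : Fin n) :
    IsHC P (Z i) (fun r => if r = 0 then 1 else η) := by
  intro c
  set e : Fin (m i + 1) → MultiIndex m := fun r => Pi.single i r with he
  have hinj : Function.Injective e := fun r t h => by
    simpa [he] using congrFun h i
  set Q : MultilinearPoly m := fun σ => ∑ r, if σ = e r then c r else 0 with hQ
  have hmon : ∀ r ω, ∏ j, Z j (e r j) ω = Z i r ω := by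
    intro r ω
    rw [Finset.prod_eq_single i, he]
    · simp
    · intro j _ hj
      simp [he, hj, (hZ.ensemble j).zero_eq_one]
    · simp
  have hdeg : ∀ r, (e r).degree = if r = 0 then 0 else 1 := by
    intro r
    split_ifs with h0
    · rw [degree_eq_zero_iff, he, h0]; simp
    · rw [MultiIndex.degree, Finset.card_eq_one]
      refine ⟨i, Finset.ext fun j => ?_⟩
      by_cases hj : j = i
      · subst hj; simp [he, h0]
      · simp [he, hj]
  have happ : ∀ (w : MultiIndex m → ℝ) ω, MultilinearPoly.apply (fun σ => w σ * Q σ) Z ω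
      = ∑ r, w (e r) * c r * Z i r ω := by
    intro w ω
    simp only [MultilinearPoly.apply, hQ, Finset.mul_sum, Finset.sum_mul]
    rw [Finset.sum_comm]
    refine Finset.sum_congr rfl fun r _ => ?_
    rw [Finset.sum_eq_single (e r) (fun b _ hb => by simp [hb]) (by simp), hmon]
    simp
  have hQr : ∀ r, Q (e r) = c r := by
    intro r
    simp only [hQ, hinj.eq_iff]
    simp
  have hsq : ∑ σ, Q σ ^ 2 = ∑ r, c r ^ 2 := by
    have : ∀ σ, Q σ ^ 2 = ∑ r, if σ = e r then c r ^ 2 else 0 := by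
      intro σ
      by_cases hσ : ∃ r, σ = e r
      · obtain ⟨r, rfl⟩ := hσ
        rw [hQr]
        simp [hinj.eq_iff]
      · push Not at hσ
        simp [hQ, hσ]
    simp only [this]
    rw [Finset.sum_comm]
    simp
  have := h Q
  rw [eLpNorm_two_le (hZ.memLp_apply Q), hZ.integral_apply_sq, hsq] at this
  convert this using 2
  funext ω
  refine Eq.trans (Finset.sum_congr rfl fun r _ => ?_) (happ (fun σ => η ^ σ.degree) ω).symm
  rw [hdeg]
  by_cases h0 : r = 0 <;> simp [h0]

end HC

/-! ### Ensembles on finite probability spaces -/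

/-- The second-order Taylor polynomial of `|·|³` at `a`, with remainder `|y|³`. The linear term is
kept with its sign so that it vanishes on integration. -/
lemma abs_add_pow_three_le (a y : ℝ) :
    |a + y| ^ 3 ≤ |a| ^ 3 + 3 * |a| * a * y + 3 * |a| * y ^ 2 + |y| ^ 3 := by
  rcases abs_cases a with ⟨h1, h1'⟩ | ⟨h1, h1'⟩ <;> rcases abs_cases y with ⟨h2, h2'⟩ | ⟨h2, h2'⟩ <;>
  rcases abs_cases (a + y) with ⟨h3, h3'⟩ | ⟨h3, h3'⟩ <;> rw [h1, h2, h3]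
  · nlinarith
  · nlinarith
  · nlinarith [pow_nonneg (neg_nonneg.2 h2'.le) 3]
  · nlinarith [mul_nonneg h1' (sq_nonneg (2 * a + 3 * y)), mul_nonneg h1' (sq_nonneg y)]
  · nlinarith [mul_nonneg (neg_nonneg.2 h1'.le) (sq_nonneg (2 * a + 3 * y)),
      mul_nonneg (neg_nonneg.2 h1'.le) (sq_nonneg y)]
  · nlinarith [pow_nonneg h2' 3]
  · nlinarith
  · nlinarith

lemma cube_moment_bound {a s : ℝ} (hs : 0 ≤ s) :
    |a| ^ 3 + 3 / 4 * |a| * s ^ 2 + 1 / 8 * s ^ 3 ≤ √(a ^ 2 + s ^ 2) ^ 3 := by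
  have ha := abs_nonneg a
  rw [← sq_abs a]
  generalize |a| = b at ha
  have h0 : 0 ≤ b ^ 2 + s ^ 2 := by positivity
  refine (pow_le_pow_iff_left₀ (by positivity) (by positivity) two_ne_zero).1 ?_
  rw [← pow_mul, mul_comm 3 2, pow_mul, Real.sq_sqrt h0]
  -- After squaring, the only negative terms in the difference of the two sides are multiples of
  -- `b³s³` and `bs⁵`, which the neighbouring even terms dominate.
  have h1 : 0 ≤ s ^ 3 * b * (b - s) ^ 2 := by positivity
  have h2 : 0 ≤ s ^ 2 * b ^ 2 * (b - s) ^ 2 := by positivity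
  have h3 : 0 ≤ s ^ 4 * (b - s) ^ 2 := by positivity
  have h4 : 0 ≤ s ^ 2 * b ^ 4 := by positivity
  have h5 : 0 ≤ s ^ 6 := by positivity
  have h6 : 0 ≤ s ^ 4 * b ^ 2 := by positivity
  nlinarith

/-- Write the function as `c 0 + η f` with `f` of mean zero and variance `s²`. One atom already
gives `α f(x)² ≤ s²`, so `η³|f| ≤ s/8` and the cubic remainder is at most `(s/8) f²`. Integrating
the expansion of `|c 0 + η f|³` leaves exactly the left side of `cube_moment_bound`. -/
lemma isHC_of_finite {Ω : Type*} [Fintype Ω] [MeasurableSpace Ω] [MeasurableSingletonClass Ω]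
    {μ : Measure Ω} [IsProbabilityMeasure μ] {m : ℕ} {φ : Fin (m + 1) → Ω → ℝ}
    (hφ : IsOrthonormalEnsemble μ φ) {α η : ℝ} (hα : 0 < α)
    (hatom : ∀ x, μ {x} ≠ 0 → α ≤ μ.real {x}) (hη : 0 < η) (hη1 : η ≤ 1 / 2)
    (hη3 : η ^ 3 ≤ √α / 8) : IsHC μ φ (fun r => if r = 0 then 1 else η) := by
  intro c
  have hint : ∀ g : Ω → ℝ, Integrable g μ := fun g => .of_finite
  set f : Ω → ℝ := fun x => ∑ r : Fin m, c r.succ * φ r.succ x with hf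
  set s : ℝ := √(∑ r : Fin m, c r.succ ^ 2) with hs
  have hs0 : 0 ≤ s := Real.sqrt_nonneg _
  have hs2 : s ^ 2 = ∑ r : Fin m, c r.succ ^ 2 :=
    Real.sq_sqrt (Finset.sum_nonneg fun _ _ => sq_nonneg _)
  have hF : ∀ x, ∑ r, (if r = 0 then 1 else η) * c r * φ r x = c 0 + η * f x := by
    intro x
    rw [Fin.sum_univ_succ, hφ.zero_eq_one, hf, Finset.mul_sum]
    simp [mul_assoc, Fin.succ_ne_zero]
  have hf1 : ∫ x, f x ∂μ = 0 := by
    rw [integral_finsetSum _ fun r _ => hint _]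
    refine Finset.sum_eq_zero fun r _ => ?_
    have := hφ.orthonormal r.succ 0
    simp only [hφ.zero_eq_one, mul_one, Fin.succ_ne_zero, if_false] at this
    rw [integral_const_mul, this, mul_zero]
  have hf2 : ∫ x, f x ^ 2 ∂μ = s ^ 2 := by
    have e : ∀ x, f x ^ 2 = ∑ r : Fin m, ∑ t : Fin m, (c r.succ * c t.succ) *
        (φ r.succ x * φ t.succ x) := by
      intro x
      rw [sq, hf, Finset.sum_mul_sum]
      exact Finset.sum_congr rfl fun r _ => Finset.sum_congr rfl fun t _ => by ring
    simp only [e]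
    rw [integral_finsetSum _ fun r _ => hint _, hs2]
    refine Finset.sum_congr rfl fun r _ => ?_
    rw [integral_finsetSum _ fun r _ => hint _]
    simp [integral_const_mul, hφ.orthonormal, sq]
  have hf3 : ∀ᵐ x ∂μ, η ^ 3 * |f x| ≤ s / 8 := by
    rw [ae_iff_of_countable]
    intro x hx
    have h1 : α * f x ^ 2 ≤ s ^ 2 := by
      rw [← hf2, integral_fintype (hint _)]
      refine le_trans ?_ (Finset.single_le_sum (f := fun x => μ.real {x} • f x ^ 2)
        (fun y _ => smul_nonneg measureReal_nonneg (sq_nonneg _)) (Finset.mem_univ x))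
      rw [smul_eq_mul]
      gcongr
      exact hatom x hx
    have h2 : √α * |f x| ≤ s := by
      refine abs_le_of_sq_le_sq' ?_ hs0 |>.2
      rwa [mul_pow, Real.sq_sqrt hα.le, sq_abs]
    calc η ^ 3 * |f x| ≤ √α / 8 * |f x| := by gcongr
      _ = √α * |f x| / 8 := by ring
      _ ≤ s / 8 := by gcongr
  have key : ∫ x, |c 0 + η * f x| ^ 3 ∂μ ≤ √(∑ r, c r ^ 2) ^ 3 := by
    calc ∫ x, |c 0 + η * f x| ^ 3 ∂μ
        ≤ ∫ x, (|c 0| ^ 3 + 3 * |c 0| * c 0 * η * f x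
          + (3 * |c 0| * η ^ 2 + s / 8) * f x ^ 2) ∂μ := by
          refine integral_mono_ae (hint _) (hint _) ?_
          filter_upwards [hf3] with x hx
          refine (abs_add_pow_three_le _ _).trans ?_
          have h4 : |η * f x| ^ 3 = (η ^ 3 * |f x|) * f x ^ 2 := by
            rw [abs_mul, mul_pow, abs_of_pos hη, ← sq_abs (f x)]; ring
          rw [h4]
          nlinarith [mul_le_mul_of_nonneg_right hx (sq_nonneg (f x))]
      _ = |c 0| ^ 3 + (3 * |c 0| * η ^ 2 + s / 8) * s ^ 2 := by
          rw [integral_add (hint _) (hint _), integral_add (hint _) (hint _), integral_const_mul,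
            integral_const_mul, hf1, hf2]
          simp
      _ ≤ |c 0| ^ 3 + 3 / 4 * |c 0| * s ^ 2 + 1 / 8 * s ^ 3 := by
          have : 3 * |c 0| * η ^ 2 * s ^ 2 ≤ 3 * |c 0| * (1 / 2) ^ 2 * s ^ 2 := by gcongr
          nlinarith
      _ ≤ √(c 0 ^ 2 + s ^ 2) ^ 3 := cube_moment_bound hs0
      _ = _ := by rw [hs2, Fin.sum_univ_succ]
  simp only [hF]
  refine (ENNReal.pow_le_pow_left_iff (by norm_num : (3 : ℕ) ≠ 0)).1 ?_
  rw [eLpNorm_three_pow, ← ENNReal.ofReal_pow (Real.sqrt_nonneg _)]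
  refine le_trans (le_of_eq ?_) (ENNReal.ofReal_le_ofReal key)
  rw [ofReal_integral_eq_lintegral_ofReal (hint _)
    (Filter.Eventually.of_forall fun x => by positivity)]
  refine lintegral_congr fun x => ?_
  rw [ENNReal.ofReal_pow (abs_nonneg _), ← Real.enorm_eq_ofReal_abs]

lemma isEnsembleSeq_productSeq {n : ℕ} {m : Fin n → ℕ} {Ω : Fin n → Type*}
    [∀ i, MeasurableSpace (Ω i)] {μ : ∀ i, Measure (Ω i)} [∀ i, IsProbabilityMeasure (μ i)]
    {φ : ∀ i, Fin (m i + 1) → Ω i → ℝ} (hφ : ∀ i, IsOrthonormalEnsemble (μ i) (φ i)) :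
    IsEnsembleSeq (Measure.pi μ) (productSeq φ) := by
  refine ⟨fun i => ⟨fun r => ((hφ i).measurable r).comp (measurable_pi_apply i),
    fun r => ((hφ i).memLp r).comp_measurePreserving (measurePreserving_eval μ i),
    fun ω => (hφ i).zero_eq_one _, fun r s => ?_⟩, ?_⟩
  · rw [← (hφ i).orthonormal r s, ← (measurePreserving_eval μ i).map_eq, integral_map
      (measurable_pi_apply i).aemeasurable]
    · rfl
    · exact (((hφ i).measurable r).mul ((hφ i).measurable s)).aestronglyMeasurable
  · exact iIndepFun_pi (X := fun i x r => φ i r x) fun i =>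
      (measurable_pi_lambda _ fun r => (hφ i).measurable r).aemeasurable

lemma isHCSeq_productSeq {n : ℕ} {m : Fin n → ℕ} {Ω : Fin n → Type*} [∀ i, Fintype (Ω i)]
    [∀ i, MeasurableSpace (Ω i)] [∀ i, MeasurableSingletonClass (Ω i)]
    {μ : ∀ i, Measure (Ω i)} [∀ i, IsProbabilityMeasure (μ i)]
    {φ : ∀ i, Fin (m i + 1) → Ω i → ℝ} (hφ : ∀ i, IsOrthonormalEnsemble (μ i) (φ i))
    {α η : ℝ} (hα : 0 < α) (hatom : ∀ i x, μ i {x} ≠ 0 → α ≤ (μ i).real {x}) (hη : 0 < η)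
    (hη1 : η ≤ 1 / 2) (hη3 : η ^ 3 ≤ √α / 8) : IsHCSeq η (Measure.pi μ) (productSeq φ) := by
  refine ⟨isEnsembleSeq_productSeq hφ, fun i => ?_⟩
  exact (isHC_of_finite (hφ i) hα (hatom i) hη hη1 hη3).reindex (hφ i).measurable (Equiv.refl _)
    (measurePreserving_eval μ i)

/-! ### Truncation -/

/-- The part of `Q` of degree at most `d`. -/
def MultilinearPoly.trunc {n : ℕ} {m : Fin n → ℕ} (d : ℕ) (Q : MultilinearPoly m) :
    MultilinearPoly m := fun σ => if d < σ.degree then 0 else Q σ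

lemma trunc_eq_zero {n : ℕ} {m : Fin n → ℕ} {d : ℕ} (Q : MultilinearPoly m) {σ : MultiIndex m}
    (h : d < σ.degree) : Q.trunc d σ = 0 := if_pos h

lemma degree_zero {n : ℕ} {m : Fin n → ℕ} : (0 : MultiIndex m).degree = 0 :=
  degree_eq_zero_iff.2 rfl

lemma trunc_apply_zero {n : ℕ} {m : Fin n → ℕ} (d : ℕ) (Q : MultilinearPoly m) :
    Q.trunc d 0 = Q 0 := if_neg (by rw [degree_zero]; exact Nat.not_lt_zero _)

lemma apply_sub_trunc_apply {S : Type*} {n : ℕ} {m : Fin n → ℕ} (d : ℕ) (Q : MultilinearPoly m)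
    (Z : ∀ i, Fin (m i + 1) → S → ℝ) (ω : S) :
    Q.apply Z ω - (Q.trunc d).apply Z ω = (Q.above d).apply Z ω := by
  simp only [MultilinearPoly.apply, ← Finset.sum_sub_distrib, MultilinearPoly.trunc,
    MultilinearPoly.above]
  refine Finset.sum_congr rfl fun σ _ => ?_
  split_ifs <;> ring

lemma coeffVar_trunc_le {n : ℕ} {m : Fin n → ℕ} (d : ℕ) (Q : MultilinearPoly m) :
    coeffVar (Q.trunc d) ≤ coeffVar Q := by
  refine Finset.sum_le_sum fun σ _ => ?_
  simp only [MultilinearPoly.trunc]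
  split_ifs <;> simp [sq_nonneg]

lemma integral_abs_le_of_integral_sq_le {S : Type*} [MeasurableSpace S] {P : Measure S}
    [IsProbabilityMeasure P] {X : S → ℝ} (hX : MemLp X 2 P) {δ : ℝ} (hδ : 0 < δ)
    (h : ∫ ω, X ω ^ 2 ∂P ≤ δ ^ 2) : ∫ ω, |X ω| ∂P ≤ δ := by
  have h2 := hX.integrable_sq
  calc ∫ ω, |X ω| ∂P ≤ ∫ ω, (δ / 2 + (2 * δ)⁻¹ * X ω ^ 2) ∂P := by
        refine integral_mono (hX.integrable (by norm_num)).abs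
          ((integrable_const _).add (h2.const_mul _)) fun ω => ?_
        have : δ / 2 + (2 * δ)⁻¹ * X ω ^ 2 - |X ω| = (2 * δ)⁻¹ * (|X ω| - δ) ^ 2 := by
          rw [← sq_abs (X ω)]; field_simp; ring
        have h3 : 0 ≤ (2 * δ)⁻¹ * (|X ω| - δ) ^ 2 := by positivity
        change |X ω| ≤ δ / 2 + (2 * δ)⁻¹ * X ω ^ 2
        linarith
    _ = δ / 2 + (2 * δ)⁻¹ * ∫ ω, X ω ^ 2 ∂P := by
        rw [integral_add (integrable_const _) (h2.const_mul _), integral_const_mul]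
        simp
    _ ≤ δ / 2 + (2 * δ)⁻¹ * δ ^ 2 := by gcongr
    _ = δ := by field_simp; ring

lemma integrable_sq_sub_clip {S : Type*} [MeasurableSpace S] {P : Measure S}
    [IsProbabilityMeasure P] {X : S → ℝ} (hX : MemLp X 2 P) :
    Integrable (fun ω => (X ω - clip (X ω)) ^ 2) P := by
  refine (hX.sub (MemLp.of_bound (C := 1)
    (continuous_clip.comp_aestronglyMeasurable hX.1) ?_)).integrable_sq
  exact Filter.Eventually.of_forall fun ω => by
    rw [Real.norm_of_nonneg (clip_nonneg _)]; exact clip_le_one _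

/-- The linear term of the expansion carries the factor `Y - clip Y`, whose second moment is not
controlled because the mean of `Y` is arbitrary. As `X - Y` has mean zero, that factor may be
recentred at `v`; since `y - clip y` is 1-Lipschitz, only `(Y - v)²` enters. The product `2|x - y||y
- v|` is split with weight `δ`. -/
lemma abs_integral_sqDist_sub_le {S : Type*} [MeasurableSpace S] {P : Measure S}
    [IsProbabilityMeasure P] {X Y : S → ℝ} (hX : MemLp X 2 P) (hY : MemLp Y 2 P) {δ v : ℝ}
    (hδ : 0 < δ) (h0 : ∫ ω, (X ω - Y ω) ∂P = 0) (h : ∫ ω, (X ω - Y ω) ^ 2 ∂P ≤ δ ^ 2)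
    (hv : ∫ ω, (Y ω - v) ^ 2 ∂P ≤ 1) :
    |∫ ω, (X ω - clip (X ω)) ^ 2 ∂P - ∫ ω, (Y ω - clip (Y ω)) ^ 2 ∂P| ≤ δ ^ 2 + 2 * δ := by
  have iX := integrable_sq_sub_clip hX
  have iY := integrable_sq_sub_clip hY
  have iD : Integrable (fun ω => X ω - Y ω) P := (hX.sub hY).integrable (by norm_num)
  have iD2 : Integrable (fun ω => (X ω - Y ω) ^ 2) P := (hX.sub hY).integrable_sq
  have iV : Integrable (fun ω => (Y ω - v) ^ 2) P := (hY.sub (memLp_const v)).integrable_sq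
  have i1 : Integrable (fun ω => (X ω - clip (X ω)) ^ 2 - (Y ω - clip (Y ω)) ^ 2) P := iX.sub iY
  have e : ∫ ω, (X ω - clip (X ω)) ^ 2 ∂P - ∫ ω, (Y ω - clip (Y ω)) ^ 2 ∂P
      = ∫ ω, ((X ω - clip (X ω)) ^ 2 - (Y ω - clip (Y ω)) ^ 2
        - 2 * (v - clip v) * (X ω - Y ω)) ∂P := by
    rw [integral_sub i1 (iD.const_mul _), integral_sub iX iY, integral_const_mul, h0]; ring
  rw [e]
  refine abs_integral_le_integral_abs.trans ?_
  calc _ ≤ ∫ ω, ((1 + δ⁻¹) * (X ω - Y ω) ^ 2 + δ * (Y ω - v) ^ 2) ∂P := by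
        refine integral_mono (i1.sub (iD.const_mul _)).abs
          ((iD2.const_mul _).add (iV.const_mul _)) fun ω => ?_
        change |(X ω - clip (X ω)) ^ 2 - (Y ω - clip (Y ω)) ^ 2
          - 2 * (v - clip v) * (X ω - Y ω)| ≤ (1 + δ⁻¹) * (X ω - Y ω) ^ 2 + δ * (Y ω - v) ^ 2
        generalize X ω = x
        generalize Y ω = y
        have h1 := abs_sq_sub_clip_sub_le x y
        have h2 : |(y - clip y) - (v - clip v)| ≤ |y - v| := by
          rcases clip_cases y with ⟨h, e⟩ | ⟨h, h', e⟩ | ⟨h, e⟩ <;>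
          rcases clip_cases v with ⟨g, e'⟩ | ⟨g, g', e'⟩ | ⟨g, e'⟩ <;> rw [e, e', abs_le] <;>
          rcases abs_cases (y - v) with ⟨a, a'⟩ | ⟨a, a'⟩ <;> rw [a] <;> constructor <;> linarith
        have h3 : (x - clip x) ^ 2 - (y - clip y) ^ 2 - 2 * (v - clip v) * (x - y)
          = ((x - clip x) ^ 2 - (y - clip y) ^ 2 - 2 * (y - clip y) * (x - y))
            + 2 * ((y - clip y) - (v - clip v)) * (x - y) := by ring
        rw [h3]
        refine (abs_add_le _ _).trans ?_
        rw [abs_mul, abs_mul, abs_two]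
        have h4 : 2 * |(y - clip y) - (v - clip v)| * |x - y| ≤ 2 * |y - v| * |x - y| := by gcongr
        have h5 : δ⁻¹ * (x - y) ^ 2 + δ * (y - v) ^ 2 - 2 * |y - v| * |x - y|
            = δ⁻¹ * (|x - y| - δ * |y - v|) ^ 2 := by
          rw [← sq_abs (x - y), ← sq_abs (y - v)]; field_simp; ring
        have h6 : 0 ≤ δ⁻¹ * (|x - y| - δ * |y - v|) ^ 2 := by positivity
        linarith
    _ = (1 + δ⁻¹) * ∫ ω, (X ω - Y ω) ^ 2 ∂P + δ * ∫ ω, (Y ω - v) ^ 2 ∂P := by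
        rw [integral_add (iD2.const_mul _) (iV.const_mul _), integral_const_mul,
          integral_const_mul]
    _ ≤ (1 + δ⁻¹) * δ ^ 2 + δ * 1 := by gcongr
    _ = _ := by field_simp; ring

section Seq

variable {S : Type*} [MeasurableSpace S] {P : Measure S} [IsProbabilityMeasure P]
  {n k : ℕ} {m : Fin n → ℕ} {Z : ∀ i, Fin (m i + 1) → S → ℝ}

lemma integrable_chi {R : Fin k → S → ℝ} (hR : ∀ j, MemLp (R j) 2 P) :
    Integrable (fun ω => chi fun j => R j ω) P :=
  Integrable.of_bound (C := 1) (continuous_chi.comp_aestronglyMeasurable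
      (aemeasurable_pi_lambda _ fun j => (hR j).1.aemeasurable).aestronglyMeasurable)
    (Filter.Eventually.of_forall fun ω => by
      rw [Real.norm_of_nonneg (chi_nonneg _)]; exact chi_le_one _)

lemma integrable_zeta {R : Fin k → S → ℝ} (hR : ∀ j, MemLp (R j) 2 P) :
    Integrable (fun ω => zeta fun j => R j ω) P :=
  integrable_finsetSum _ fun j _ => integrable_sq_sub_clip (hR j)

lemma IsEnsembleSeq.abs_integral_chi_trunc_le (hZ : IsEnsembleSeq P Z)
    (Q : Fin k → MultilinearPoly m) {d : ℕ} {δ : ℝ} (hδ : 0 < δ)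
    (h : ∀ j, ∑ σ, (Q j).above d σ ^ 2 ≤ δ ^ 2) :
    |∫ ω, chi (fun j => (Q j).apply Z ω) ∂P - ∫ ω, chi (fun j => ((Q j).trunc d).apply Z ω) ∂P|
      ≤ k * δ := by
  have i1 := integrable_chi fun j => hZ.memLp_apply (Q j)
  have i2 := integrable_chi fun j => hZ.memLp_apply ((Q j).trunc d)
  have i3 := fun j => ((hZ.memLp_apply ((Q j).above d)).integrable (by norm_num)).abs
  rw [← integral_sub i1 i2]
  refine abs_integral_le_integral_abs.trans ?_
  calc _ ≤ ∫ ω, ∑ j, |((Q j).above d).apply Z ω| ∂P := by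
        refine integral_mono (i1.sub i2).abs (integrable_finsetSum _ fun j _ => i3 j) fun ω => ?_
        refine (abs_chi_sub_chi_le _ _).trans (le_of_eq ?_)
        simp only [apply_sub_trunc_apply]
    _ = ∑ j, ∫ ω, |((Q j).above d).apply Z ω| ∂P := integral_finsetSum _ fun j _ => i3 j
    _ ≤ ∑ j : Fin k, δ := by
        refine Finset.sum_le_sum fun j _ => integral_abs_le_of_integral_sq_le
          (hZ.memLp_apply _) hδ ?_
        rw [hZ.integral_apply_sq]
        exact h j
    _ = _ := by simp

lemma IsEnsembleSeq.abs_integral_zeta_trunc_le (hZ : IsEnsembleSeq P Z)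
    (Q : Fin k → MultilinearPoly m) {d : ℕ} {δ : ℝ} (hδ : 0 < δ) (hδ1 : δ ≤ 1)
    (h : ∀ j, ∑ σ, (Q j).above d σ ^ 2 ≤ δ ^ 2) (hv : ∀ j, coeffVar (Q j) ≤ 1) :
    |∫ ω, zeta (fun j => (Q j).apply Z ω) ∂P - ∫ ω, zeta (fun j => ((Q j).trunc d).apply Z ω) ∂P|
      ≤ k * (3 * δ) := by
  have hL := fun j => hZ.memLp_apply (Q j)
  have hL' := fun j => hZ.memLp_apply ((Q j).trunc d)
  unfold zeta
  rw [integral_finsetSum _ fun j _ => integrable_sq_sub_clip (hL j),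
    integral_finsetSum _ fun j _ => integrable_sq_sub_clip (hL' j), ← Finset.sum_sub_distrib]
  refine (Finset.abs_sum_le_sum_abs _ _).trans ?_
  calc _ ≤ ∑ j : Fin k, 3 * δ := by
        refine Finset.sum_le_sum fun j _ => ?_
        refine (abs_integral_sqDist_sub_le (hL j) (hL' j) (v := Q j 0) hδ ?_ ?_ ?_).trans ?_
        · simp only [apply_sub_trunc_apply, hZ.integral_apply]
          simp [MultilinearPoly.above, degree_zero]
        · simp only [apply_sub_trunc_apply, hZ.integral_apply_sq]
          exact h j
        · rw [← trunc_apply_zero d (Q j), hZ.integral_sub_sq]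
          exact (coeffVar_trunc_le d _).trans (hv j)
        · nlinarith
    _ = _ := by simp

end Seq

/-! ### The invariance principle for smooth functions -/

lemma IsHCSeq.integral_comp_apply {S : Type*} [MeasurableSpace S] {P : Measure S}
    [IsProbabilityMeasure P] {n k : ℕ} {m : Fin n → ℕ} {Z : ∀ i, Fin (m i + 1) → S → ℝ} {η : ℝ}
    (hZ : IsHCSeq η P Z) {Ψ : (Fin k → ℝ) → ℝ} (hc : Continuous Ψ)
    (Q : Fin k → MultilinearPoly m) :
    ∫ ω, Ψ (fun j => (Q j).apply Z ω) ∂P = ∫ x, Ψ (fun j => (Q j).apply (coordSeq m) x)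
      ∂(Measure.pi fun i => P.map fun ω r => Z i r ω) := by
  rw [← hZ.seq.measurePreserving.map_eq, integral_map hZ.seq.measurePreserving.measurable.aemeasurable]
  · rfl
  · exact (hc.measurable.comp (measurable_pi_lambda _ fun j =>
      measurable_apply_coordSeq (Q j))).aestronglyMeasurable

section Invariance

variable {S S' : Type*} [MeasurableSpace S] [MeasurableSpace S'] {P : Measure S} {P' : Measure S'}
  [IsProbabilityMeasure P] [IsProbabilityMeasure P'] {n k : ℕ} {m : Fin n → ℕ}
  {Z : ∀ i, Fin (m i + 1) → S → ℝ} {Z' : ∀ i, Fin (m i + 1) → S' → ℝ} {η τ B : ℝ}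

lemma IsHCSeq.memLp_three (hZ : IsHCSeq η P Z) (hη : 0 < η) (hη1 : η ≤ 1)
    (Q : MultilinearPoly m) : MemLp (Q.apply Z) 3 P := by
  have h := memLp_apply hZ.isEnsembleLaw hη hη1 Q
  have h' := h.comp_measurePreserving hZ.seq.measurePreserving
  have e : Q.apply (coordSeq m) ∘ (fun ω i r => Z i r ω) = Q.apply Z := rfl
  rwa [e] at h'

/-- The invariance principle for smooth test functions and polynomials of bounded degree. -/
lemma invariance_smooth (hZ : IsHCSeq η P Z) (hZ' : IsHCSeq η P' Z') (hη : 0 < η) (hη1 : η ≤ 1)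
    (hB : 0 ≤ B) {Ψ : (Fin k → ℝ) → ℝ} (hΨ : HasCubicTaylor Ψ B) (hc : Continuous Ψ)
    (Q : Fin k → MultilinearPoly m) {d : ℕ} (hQ : ∀ j σ, d < σ.degree → Q j σ = 0)
    (hτ : ∀ i, ∑ j, ∑ σ, (Q j).partAt i σ ^ 2 ≤ τ) (hv : ∑ j, coeffVar (Q j) ≤ 1) :
    |∫ ω, Ψ (fun j => (Q j).apply Z ω) ∂P - ∫ ω, Ψ (fun j => (Q j).apply Z' ω) ∂P'|
      ≤ 2 * B * ((η⁻¹ ^ d) ^ 3 * (√τ * d)) := by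
  rw [hZ.integral_comp_apply hc, hZ'.integral_comp_apply hc]
  refine (replace_all hη hη1 hB hΨ hc Q hQ hZ.isEnsembleLaw hZ'.isEnsembleLaw).trans ?_
  rw [mul_assoc (2 * B)]
  gcongr
  exact sum_sqrt_partAt_le Q hQ hτ hv

/-- Approximating a test function by a smooth one. -/
lemma abs_integral_sub_le_of_approx {Φ Ψ : (Fin k → ℝ) → ℝ} {ε E : ℝ} {R : Fin k → S → ℝ}
    {R' : Fin k → S' → ℝ} (hε : ∀ x, |Ψ x - Φ x| ≤ ε)
    (i1 : Integrable (fun ω => Φ fun j => R j ω) P)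
    (i2 : Integrable (fun ω => Ψ fun j => R j ω) P)
    (i3 : Integrable (fun ω => Φ fun j => R' j ω) P')
    (i4 : Integrable (fun ω => Ψ fun j => R' j ω) P')
    (hE : |∫ ω, Ψ (fun j => R j ω) ∂P - ∫ ω, Ψ (fun j => R' j ω) ∂P'| ≤ E) :
    |∫ ω, Φ (fun j => R j ω) ∂P - ∫ ω, Φ (fun j => R' j ω) ∂P'| ≤ 2 * ε + E := by
  have h1 : |∫ ω, Ψ (fun j => R j ω) ∂P - ∫ ω, Φ (fun j => R j ω) ∂P| ≤ ε := by
    rw [← integral_sub i2 i1]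
    refine abs_integral_le_integral_abs.trans ?_
    have := integral_mono (i2.sub i1).abs (integrable_const (μ := P) ε) fun ω => hε _
    simpa using this
  have h2 : |∫ ω, Ψ (fun j => R' j ω) ∂P' - ∫ ω, Φ (fun j => R' j ω) ∂P'| ≤ ε := by
    rw [← integral_sub i4 i3]
    refine abs_integral_le_integral_abs.trans ?_
    have := integral_mono (i4.sub i3).abs (integrable_const (μ := P') ε) fun ω => hε _
    simpa using this
  rw [abs_le] at *
  constructor <;> linarith [h1.1, h1.2, h2.1, h2.2, hE.1, hE.2]

/-- The invariance principle for `chi`, with explicit error terms. -/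
lemma invariance_chi (hZ : IsHCSeq η P Z) (hZ' : IsHCSeq η P' Z') (hη : 0 < η) (hη1 : η ≤ 1)
    (Q : Fin k → MultilinearPoly m) {d : ℕ} {δ l : ℝ} (hl : 0 < l) (hl1 : l ≤ 1) (hδ : 0 < δ)
    (h : ∀ j, ∑ σ, (Q j).above d σ ^ 2 ≤ δ ^ 2)
    (hτ : ∀ i, ∑ j, ∑ σ, ((Q j).trunc d).partAt i σ ^ 2 ≤ τ) (hv : ∑ j, coeffVar (Q j) ≤ 1) :
    |∫ ω, chi (fun j => (Q j).apply Z ω) ∂P - ∫ ω, chi (fun j => (Q j).apply Z' ω) ∂P'|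
      ≤ 2 * (k * δ) + 2 * (k * l) + 2 * (12 / l ^ 2) ^ k * ((η⁻¹ ^ d) ^ 3 * (√τ * d)) := by
  have t1 := hZ.seq.abs_integral_chi_trunc_le Q hδ h
  have t2 := hZ'.seq.abs_integral_chi_trunc_le Q hδ h
  have hv' : ∑ j, coeffVar ((Q j).trunc d) ≤ 1 :=
    (Finset.sum_le_sum fun j _ => coeffVar_trunc_le d (Q j)).trans hv
  have hs := softChi_taylor (k := k) hl hl1
  have t3 := abs_integral_sub_le_of_approx (abs_softChi_sub_chi_le hl)
    (integrable_chi fun j => hZ.seq.memLp_apply ((Q j).trunc d))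
    (hs.integrable_comp continuous_softChi fun j => hZ.memLp_three hη hη1 ((Q j).trunc d))
    (integrable_chi fun j => hZ'.seq.memLp_apply ((Q j).trunc d))
    (hs.integrable_comp continuous_softChi fun j => hZ'.memLp_three hη hη1 ((Q j).trunc d))
    (invariance_smooth hZ hZ' hη hη1 (by positivity) hs continuous_softChi
      (fun j => (Q j).trunc d) (fun j σ => trunc_eq_zero (Q j)) hτ hv')
  rw [abs_le] at *
  constructor <;> linarith [t1.1, t1.2, t2.1, t2.2, t3.1, t3.2]

/-- The invariance principle for `zeta`, with explicit error terms. -/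
lemma invariance_zeta (hZ : IsHCSeq η P Z) (hZ' : IsHCSeq η P' Z') (hη : 0 < η) (hη1 : η ≤ 1)
    (Q : Fin k → MultilinearPoly m) {d : ℕ} {δ l : ℝ} (hl : 0 < l) (hδ : 0 < δ) (hδ1 : δ ≤ 1)
    (h : ∀ j, ∑ σ, (Q j).above d σ ^ 2 ≤ δ ^ 2)
    (hτ : ∀ i, ∑ j, ∑ σ, ((Q j).trunc d).partAt i σ ^ 2 ≤ τ) (hv : ∑ j, coeffVar (Q j) ≤ 1) :
    |∫ ω, zeta (fun j => (Q j).apply Z ω) ∂P - ∫ ω, zeta (fun j => (Q j).apply Z' ω) ∂P'|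
      ≤ 2 * (k * (3 * δ)) + 2 * (k * l ^ 2) + 2 * (6 / l) * ((η⁻¹ ^ d) ^ 3 * (√τ * d)) := by
  have hvj : ∀ j, coeffVar (Q j) ≤ 1 := fun j =>
    (Finset.single_le_sum (fun j _ => coeffVar_nonneg (Q j)) (Finset.mem_univ j)).trans hv
  have t1 := hZ.seq.abs_integral_zeta_trunc_le Q hδ hδ1 h hvj
  have t2 := hZ'.seq.abs_integral_zeta_trunc_le Q hδ hδ1 h hvj
  have hv' : ∑ j, coeffVar ((Q j).trunc d) ≤ 1 :=
    (Finset.sum_le_sum fun j _ => coeffVar_trunc_le d (Q j)).trans hv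
  have hs := softZeta_taylor (k := k) hl
  have t3 := abs_integral_sub_le_of_approx (abs_softZeta_sub_zeta_le hl)
    (integrable_zeta fun j => hZ.seq.memLp_apply ((Q j).trunc d))
    (hs.integrable_comp continuous_softZeta fun j => hZ.memLp_three hη hη1 ((Q j).trunc d))
    (integrable_zeta fun j => hZ'.seq.memLp_apply ((Q j).trunc d))
    (hs.integrable_comp continuous_softZeta fun j => hZ'.memLp_three hη hη1 ((Q j).trunc d))
    (invariance_smooth hZ hZ' hη hη1 (by positivity) hs continuous_softZeta
      (fun j => (Q j).trunc d) (fun j σ => trunc_eq_zero (Q j)) hτ hv')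
  rw [abs_le] at *
  constructor <;> linarith [t1.1, t1.2, t2.1, t2.2, t3.1, t3.2]

end Invariance

/-! ### The expectations of `chi` cannot be far apart -/

section Gap

variable {S : Type*} [MeasurableSpace S] {P : Measure S} [IsProbabilityMeasure P]

lemma integral_sub_sub_sq {X : S → ℝ} (hX : MemLp X 2 P) (b : ℝ) :
    ∫ ω, (X ω - (∫ ω', X ω' ∂P) - b) ^ 2 ∂P = variance X P + b ^ 2 := by
  rw [variance_eq_integral hX.1.aemeasurable]
  set μ := ∫ ω', X ω' ∂P with hμ
  have i0 : Integrable (fun ω => X ω - μ) P := (hX.integrable (by norm_num)).sub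
    (integrable_const _)
  have i1 : Integrable (fun ω => (X ω - μ) ^ 2) P := (hX.sub (memLp_const μ)).integrable_sq
  have i2 : Integrable (fun ω => (X ω - μ) ^ 2 - 2 * b * (X ω - μ)) P := i1.sub (i0.const_mul _)
  have e : ∀ ω, (X ω - μ - b) ^ 2 = (X ω - μ) ^ 2 - 2 * b * (X ω - μ) + b ^ 2 := by
    intro ω; ring
  have z : ∫ ω, (X ω - μ) ∂P = 0 := by
    rw [integral_sub (hX.integrable (by norm_num)) (integrable_const _), ← hμ]; simp
  simp only [e]
  rw [integral_add i2 (integrable_const _), integral_sub i1 (i0.const_mul _), integral_const_mul, z]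
  simp

lemma integrable_clip {X : S → ℝ} (hX : MemLp X 2 P) : Integrable (fun ω => clip (X ω)) P :=
  Integrable.of_bound (C := 1) (continuous_clip.comp_aestronglyMeasurable hX.1)
    (Filter.Eventually.of_forall fun ω => by
      rw [Real.norm_of_nonneg (clip_nonneg _)]; exact clip_le_one _)

/-- A one-sided Chebyshev argument: after moving the mean up to `1 - ε`, `clip` lies below the
parabola `(1 + ε(y - 1))²`, which needs `ε ≤ 1/2`. Its expectation depends only on the mean and the
variance. -/
lemma integral_clip_le {X : S → ℝ} (hX : MemLp X 2 P) (hv : variance X P ≤ 1) {ε : ℝ}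
    (hε : 0 < ε) (hε1 : ε ≤ 1 / 2) (hm : ∫ ω, X ω ∂P ≤ 1 - ε) :
    ∫ ω, clip (X ω) ∂P ≤ 1 - ε ^ 2 + ε ^ 4 := by
  set μ := ∫ ω', X ω' ∂P with hμ
  have hpt : ∀ x, clip x ≤ ε ^ 2 * (x - μ - -(ε⁻¹ - ε)) ^ 2 := by
    intro x
    have h1 : clip x ≤ clip (x + (1 - ε - μ)) := clip_mono (by linarith)
    refine h1.trans ?_
    have e : ε ^ 2 * (x - μ - -(ε⁻¹ - ε)) ^ 2 = (1 + ε * (x + (1 - ε - μ) - 1)) ^ 2 := by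
      field_simp; ring
    rw [e]
    generalize x + (1 - ε - μ) = y
    rcases clip_cases y with ⟨h, e⟩ | ⟨h, h', e⟩ | ⟨h, e⟩
    · rw [e]; positivity
    · rw [e]; nlinarith [sq_nonneg (ε * (y - 1))]
    · rw [e]; nlinarith [mul_nonneg hε.le (sub_nonneg.2 h)]
  have i2 : Integrable (fun ω => (X ω - μ - -(ε⁻¹ - ε)) ^ 2) P :=
    ((hX.sub (memLp_const μ)).sub (memLp_const (-(ε⁻¹ - ε)))).integrable_sq
  refine (integral_mono (integrable_clip hX) (i2.const_mul (ε ^ 2)) fun ω => hpt _).trans ?_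
  rw [integral_const_mul, integral_sub_sub_sq hX]
  calc ε ^ 2 * (variance X P + (-(ε⁻¹ - ε)) ^ 2) ≤ ε ^ 2 * (1 + (-(ε⁻¹ - ε)) ^ 2) := by gcongr
    _ = 1 - ε ^ 2 + ε ^ 4 := by field_simp; ring

lemma one_sub_sum_le_prod_one_sub {ι : Type*} (s : Finset ι) (a : ι → ℝ)
    (h0 : ∀ i ∈ s, 0 ≤ a i) (h1 : ∀ i ∈ s, a i ≤ 1) :
    1 - ∑ i ∈ s, a i ≤ ∏ i ∈ s, (1 - a i) := by
  classical
  induction s using Finset.induction_on with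
  | empty => simp
  | insert i s hi ih =>
    rw [Finset.sum_insert hi, Finset.prod_insert hi]
    have h2 := ih (fun j hj => h0 j (Finset.mem_insert_of_mem hj))
      (fun j hj => h1 j (Finset.mem_insert_of_mem hj))
    have h3 := h0 i (Finset.mem_insert_self _ _)
    have h4 := h1 i (Finset.mem_insert_self _ _)
    have h5 : 0 ≤ ∑ j ∈ s, a j := Finset.sum_nonneg fun j hj => h0 j (Finset.mem_insert_of_mem hj)
    nlinarith [mul_le_mul_of_nonneg_left h2 (sub_nonneg.2 h4), mul_nonneg h3 h5]

/-- Each factor satisfies `clip y ≥ (1 - (y - w)²/w²)/2`, a downward parabola through the origin. If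
all parabolas are nonnegative, `∏ (1 - a_j) ≥ 1 - ∑ a_j` finishes; otherwise the left side is
negative. -/
lemma chi_ge_quadratic {k : ℕ} {w : ℝ} (hw : 1 ≤ w) (y : Fin k → ℝ) :
    (1 / 2) ^ k * (1 - ∑ j, (y j - w) ^ 2 / w ^ 2) ≤ chi y := by
  by_cases h : ∀ j, (y j - w) ^ 2 / w ^ 2 ≤ 1
  · calc (1 / 2) ^ k * (1 - ∑ j, (y j - w) ^ 2 / w ^ 2)
        ≤ (1 / 2) ^ k * ∏ j, (1 - (y j - w) ^ 2 / w ^ 2) := by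
          gcongr
          exact one_sub_sum_le_prod_one_sub _ _ (fun j _ => by positivity) fun j _ => h j
      _ = ∏ j, (1 / 2 * (1 - (y j - w) ^ 2 / w ^ 2)) := by
          rw [Finset.prod_mul_distrib]; simp
      _ ≤ _ := by
          refine Finset.prod_le_prod (fun j _ => by linarith [h j]) fun j _ => ?_
          have hj : (y j - w) ^ 2 / w ^ 2 * w ^ 2 = (y j - w) ^ 2 := by field_simp
          have hj1 := h j
          have hw2 : 1 ≤ w ^ 2 := one_le_pow₀ hw
          rcases clip_cases (y j) with ⟨h, e⟩ | ⟨h, h', e⟩ | ⟨h, e⟩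
          · rw [e]
            have : 1 ≤ (y j - w) ^ 2 / w ^ 2 := by
              rw [le_div_iff₀ (by positivity)]; nlinarith
            linarith
          · rw [e]
            have : 1 - 2 * y j ≤ (y j - w) ^ 2 / w ^ 2 := by
              rw [le_div_iff₀ (by positivity)]
              nlinarith [mul_nonneg h (sub_nonneg.2 hw), mul_nonneg (mul_nonneg h
                (sub_nonneg.2 hw)) (by linarith : 0 ≤ w)]
            linarith
          · rw [e]
            have : 0 ≤ (y j - w) ^ 2 / w ^ 2 := by positivity
            linarith
  · push Not at h
    obtain ⟨j, hj⟩ := h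
    have : 1 < ∑ j, (y j - w) ^ 2 / w ^ 2 := hj.trans_le
      (Finset.single_le_sum (f := fun j => (y j - w) ^ 2 / w ^ 2) (fun j _ => by positivity)
        (Finset.mem_univ j))
    refine le_trans ?_ (chi_nonneg y)
    exact mul_nonpos_of_nonneg_of_nonpos (by positivity) (by linarith)

lemma chi_mono {k : ℕ} {x y : Fin k → ℝ} (h : ∀ j, x j ≤ y j) : chi x ≤ chi y :=
  Finset.prod_le_prod (fun _ _ => clip_nonneg _) fun j _ => clip_mono (h j)

lemma le_integral_chi {k : ℕ} (hk : 0 < k) {R : Fin k → S → ℝ} (hR : ∀ j, MemLp (R j) 2 P)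
    (hv : ∑ j, variance (R j) P ≤ 1) (hm : ∀ j, 1 - 1 / (4 * k : ℝ) ≤ ∫ ω, R j ω ∂P) :
    (1 / 2) ^ k * (1 / (16 * k)) ≤ ∫ ω, chi (fun j => R j ω) ∂P := by
  have hk' : (1 : ℝ) ≤ k := by exact_mod_cast hk
  have hk0 : (0 : ℝ) < k := by linarith
  -- The vertex must exceed 1, since total variance one would use up the whole bound at `w = 1`.
  -- With this choice `w²` gains `2/k`, while the offset `b` between `w` and the means costs only `k
  -- * b² = 25/(16k)`.
  set w : ℝ := 1 + 1 / k with hw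
  have hw1 : 1 ≤ w := by rw [hw]; linarith [one_div_pos.2 hk0]
  set b : ℝ := 5 / (4 * k) with hb
  have hi : ∀ j, Integrable (fun ω => (R j ω - (∫ ω', R j ω' ∂P) - b) ^ 2 / w ^ 2) P := fun j =>
    (((hR j).sub (memLp_const (∫ ω', R j ω' ∂P))).sub (memLp_const b)).integrable_sq.div_const _
  have hi' : Integrable (fun ω => (1 / 2 : ℝ) ^ k *
      (1 - ∑ j, (R j ω - (∫ ω', R j ω' ∂P) - b) ^ 2 / w ^ 2)) P :=
    ((integrable_const _).sub (integrable_finsetSum _ fun j _ => hi j)).const_mul _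
  have hpt : ∀ ω, (1 / 2) ^ k * (1 - ∑ j, (R j ω - (∫ ω', R j ω' ∂P) - b) ^ 2 / w ^ 2)
      ≤ chi fun j => R j ω := by
    intro ω
    -- By monotonicity the components may be lowered until every mean is exactly `1 - 1/(4k)`.
    refine le_trans ?_ (chi_mono (x := fun j => R j ω - ((∫ ω', R j ω' ∂P) - (1 - 1 / (4 * k))))
      fun j => by linarith [hm j])
    refine le_trans (le_of_eq ?_) (chi_ge_quadratic hw1 _)
    have hbw : 1 - 1 / (4 * k) - w = -b := by rw [hw, hb]; field_simp; ring
    congr 3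
    funext j
    congr 2
    linarith
  refine le_trans ?_ (integral_mono hi' (integrable_chi hR) hpt)
  rw [integral_const_mul, integral_sub (integrable_const _)
    (integrable_finsetSum _ fun j _ => hi j), integral_finsetSum _ fun j _ => hi j]
  simp only [integral_div, integral_sub_sub_sq (hR _), integral_const, probReal_univ, one_smul]
  rw [← Finset.sum_div, Finset.sum_add_distrib]
  gcongr
  simp only [Finset.sum_const, Finset.card_univ, Fintype.card_fin, nsmul_eq_mul]
  have h1 : (∑ j, variance (R j) P + k * b ^ 2) / w ^ 2 ≤ (1 + k * b ^ 2) / w ^ 2 := by gcongr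
  have h2 : (1 + k * b ^ 2) / w ^ 2 ≤ 1 - 1 / (16 * k) := by
    rw [div_le_iff₀ (by positivity), hw, hb]
    have : (1 - 1 / (16 * (k : ℝ))) * (1 + 1 / k) ^ 2 - (1 + k * (5 / (4 * k)) ^ 2)
        = (6 * k ^ 2 + 14 * k - 1) / (16 * k ^ 3) := by
      field_simp; ring
    have h3 : 0 ≤ (6 * (k : ℝ) ^ 2 + 14 * k - 1) / (16 * k ^ 3) :=
      div_nonneg (by nlinarith) (by positivity)
    linarith
  linarith

/-- If two random vectors have the same mean and total variance at most one, then the expectations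
of `chi` differ by at most a constant smaller than one. -/
lemma exists_chi_gap (k : ℕ) : ∃ δ : ℝ, 0 < δ ∧ δ < 1 ∧
    ∀ (S : Type u) [MeasurableSpace S] (P : Measure S) [IsProbabilityMeasure P]
      (S' : Type v) [MeasurableSpace S'] (P' : Measure S') [IsProbabilityMeasure P']
      (R : Fin k → S → ℝ) (R' : Fin k → S' → ℝ), (∀ j, MemLp (R j) 2 P) →
      (∀ j, MemLp (R' j) 2 P') → ∑ j, variance (R j) P ≤ 1 → ∑ j, variance (R' j) P' ≤ 1 →
      (∀ j, ∫ ω, R j ω ∂P = ∫ ω, R' j ω ∂P') →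
      |∫ ω, chi (fun j => R j ω) ∂P - ∫ ω, chi (fun j => R' j ω) ∂P'| ≤ 1 - δ := by
  rcases Nat.eq_zero_or_pos k with rfl | hk
  · refine ⟨1 / 2, by norm_num, by norm_num, ?_⟩
    intros
    simp [chi]
    norm_num
  have hk' : (1 : ℝ) ≤ k := by exact_mod_cast hk
  have hk0 : (0 : ℝ) < k := by linarith
  set ε : ℝ := 1 / (4 * k) with hε
  have hε0 : 0 < ε := by positivity
  have hε1 : ε ≤ 1 / 2 := by
    rw [hε, div_le_div_iff₀ (by positivity) (by norm_num)]; linarith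
  have hp : (0 : ℝ) < ε ^ 2 - ε ^ 4 := by
    have h2 : ε ^ 2 < 1 := by nlinarith
    have h4 : ε ^ 2 - ε ^ 4 = ε ^ 2 * (1 - ε ^ 2) := by ring
    rw [h4]
    exact mul_pos (by positivity) (by linarith)
  have hq : (0 : ℝ) < (1 / 2) ^ k * (1 / (16 * k)) := by positivity
  refine ⟨min (ε ^ 2 - ε ^ 4) ((1 / 2) ^ k * (1 / (16 * k))), lt_min hp hq,
    (min_le_left _ _).trans_lt (by nlinarith [sq_nonneg (ε ^ 2)]), ?_⟩
  intro S _ P _ S' _ P' _ R R' hR hR' hv hv' hm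
  have n1 : 0 ≤ ∫ ω, chi (fun j => R j ω) ∂P := integral_nonneg fun ω => chi_nonneg _
  have n2 : 0 ≤ ∫ ω, chi (fun j => R' j ω) ∂P' := integral_nonneg fun ω => chi_nonneg _
  have u1 : ∫ ω, chi (fun j => R j ω) ∂P ≤ 1 := by
    simpa using integral_mono (integrable_chi hR) (integrable_const 1) fun ω => chi_le_one _
  have u2 : ∫ ω, chi (fun j => R' j ω) ∂P' ≤ 1 := by
    simpa using integral_mono (integrable_chi hR') (integrable_const 1) fun ω => chi_le_one _
  -- The means agree, so the same case holds for both vectors: either both expectations stay away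
  -- from 0, or both stay away from 1.
  by_cases h : ∀ j, 1 - ε ≤ ∫ ω, R j ω ∂P
  · have l1 := le_integral_chi hk hR hv h
    have l2 := le_integral_chi hk hR' hv' fun j => (h j).trans (hm j).le
    have := min_le_right (ε ^ 2 - ε ^ 4) ((1 / 2 : ℝ) ^ k * (1 / (16 * k)))
    rw [abs_le]
    constructor <;> linarith
  · push Not at h
    obtain ⟨j, hj⟩ := h
    have chi_le : ∀ (x : Fin k → ℝ), chi x ≤ clip (x j) := by
      intro x
      rw [chi, ← Finset.mul_prod_erase _ _ (Finset.mem_univ j)]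
      exact mul_le_of_le_one_right (clip_nonneg _)
        (Finset.prod_le_one (fun _ _ => clip_nonneg _) fun _ _ => clip_le_one _)
    have v1 : variance (R j) P ≤ 1 := (Finset.single_le_sum
      (f := fun j => variance (R j) P) (fun j _ => variance_nonneg _ _) (Finset.mem_univ j)).trans hv
    have v2 : variance (R' j) P' ≤ 1 := (Finset.single_le_sum
      (f := fun j => variance (R' j) P') (fun j _ => variance_nonneg _ _)
      (Finset.mem_univ j)).trans hv'
    have c1 := (integral_mono (integrable_chi hR) (integrable_clip (hR j)) fun ω => chi_le _).trans
      (integral_clip_le (hR j) v1 hε0 hε1 hj.le)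
    have c2 := (integral_mono (integrable_chi hR') (integrable_clip (hR' j)) fun ω => chi_le _).trans
      (integral_clip_le (hR' j) v2 hε0 hε1 ((hm j).symm.trans_le hj.le))
    have := min_le_left (ε ^ 2 - ε ^ 4) ((1 / 2 : ℝ) ^ k * (1 / (16 * k)))
    rw [abs_le]
    constructor <;> linarith

end Gap

/-! ### Choice of the parameters -/

lemma half_le_log_inv {α : ℝ} (hα : 0 < α) (hα2 : α ≤ 1 / 2) : 1 / 2 ≤ Real.log (1 / α) := by
  have h2 : (2 : ℝ) ≤ 1 / α := by rw [le_div_iff₀ hα]; linarith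
  have := Real.log_le_log two_pos h2
  linarith [Real.log_two_gt_d9]

lemma eta_pos {α : ℝ} (hα : 0 < α) : 0 < 1 / 2 * α ^ (1 / 6 : ℝ) := by positivity

lemma eta_le_half {α : ℝ} (hα : 0 < α) (hα2 : α ≤ 1 / 2) : 1 / 2 * α ^ (1 / 6 : ℝ) ≤ 1 / 2 := by
  have : α ^ (1 / 6 : ℝ) ≤ 1 := Real.rpow_le_one hα.le (by linarith) (by norm_num)
  linarith

lemma eta_pow_three {α : ℝ} (hα : 0 < α) : (1 / 2 * α ^ (1 / 6 : ℝ)) ^ 3 = √α / 8 := by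
  rw [mul_pow, ← Real.rpow_natCast (α ^ (1 / 6 : ℝ)), ← Real.rpow_mul hα.le, Real.sqrt_eq_rpow]
  norm_num
  ring

/-- The loss from hypercontractivity is compensated by the smallness of the influences. -/
lemma hypercontractive_loss_le {α τ : ℝ} (hα : 0 < α) (hα2 : α ≤ 1 / 2) (hτ : 0 < τ)
    {d : ℕ} (hd : d * Real.log (1 / α) ≤ Real.log (1 / τ) / 18) :
    (((1 / 2 * α ^ (1 / 6 : ℝ))⁻¹ ^ d) ^ 3 * (√τ * d)) ≤ Real.exp (-(Real.log (1 / τ) / 4)) := by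
  have hK : Real.exp (Real.log (1 / α)) = α⁻¹ := by rw [Real.exp_log (by positivity), one_div]
  have h2 : (2 : ℝ) ≤ Real.exp (Real.log (1 / α)) := by
    rw [hK, le_inv_comm₀ two_pos hα]; linarith
  set K := Real.log (1 / α) with hKd
  set L := Real.log (1 / τ) with hL
  have hα' : α = Real.exp (-K) := by rw [Real.exp_neg, hK, inv_inv]
  have hτ' : √τ = Real.exp (-(L / 2)) := by
    rw [Real.sqrt_eq_rpow, Real.rpow_def_of_pos hτ, hL, one_div τ, Real.log_inv]; congr 1; ring
  -- The cube is `8 / √α`; the 8 is absorbed into `exp (3K)` because `2 ≤ exp K`.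
  have h3 : ((1 / 2 * α ^ (1 / 6 : ℝ))⁻¹) ^ 3 ≤ Real.exp (7 / 2 * K) := by
    rw [inv_pow, eta_pow_three hα, Real.sqrt_eq_rpow, hα', ← Real.exp_mul, inv_div]
    calc 8 / Real.exp (-K * (1 / 2)) = 2 ^ 3 * Real.exp (K * (1 / 2)) := by
          rw [div_eq_mul_inv, ← Real.exp_neg]; congr 1
          · norm_num
          · congr 1; ring
      _ ≤ Real.exp K ^ 3 * Real.exp (K * (1 / 2)) := by gcongr
      _ = _ := by rw [← Real.exp_nat_mul, ← Real.exp_add]; congr 1; push_cast; ring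
  have h4 : (d : ℝ) ≤ Real.exp (d * K) := by
    calc (d : ℝ) ≤ 2 ^ d := by exact_mod_cast Nat.lt_two_pow_self.le
      _ ≤ Real.exp K ^ d := by gcongr
      _ = _ := by rw [← Real.exp_nat_mul]
  calc (((1 / 2 * α ^ (1 / 6 : ℝ))⁻¹ ^ d) ^ 3 * (√τ * d))
      = (((1 / 2 * α ^ (1 / 6 : ℝ))⁻¹) ^ 3) ^ d * (√τ * d) := by
        rw [← pow_mul, ← pow_mul, mul_comm d 3]
    _ ≤ Real.exp (7 / 2 * K) ^ d * (Real.exp (-(L / 2)) * Real.exp (d * K)) := by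
        rw [hτ']; gcongr
    -- Here `9/2 = 7/2 + 1`, the 1 coming from `d ≤ exp (d K)`. The bound `d K ≤ L/18` makes this at
    -- most `L/4`, half of what `√τ` provides.
    _ = Real.exp (9 / 2 * (d * K) - L / 2) := by
        rw [← Real.exp_nat_mul, ← Real.exp_add, ← Real.exp_add]; congr 1; ring
    _ ≤ _ := by
        rw [Real.exp_le_exp]
        linarith

/-- The loss from truncation. -/
lemma truncation_loss_le {γ y : ℝ} (hγ1 : γ < 1) (hγ : 0 < γ) :
    (1 - γ) ^ ⌊y⌋₊ ≤ 3 * Real.exp (-(γ * y)) := by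
  have h1 : 1 - γ ≤ Real.exp (-γ) := by linarith [Real.add_one_le_exp (-γ)]
  have h2 : y - 1 ≤ (⌊y⌋₊ : ℝ) := by linarith [Nat.lt_floor_add_one y]
  calc (1 - γ) ^ ⌊y⌋₊ ≤ Real.exp (-γ) ^ ⌊y⌋₊ := by gcongr
    _ = Real.exp (-(γ * ⌊y⌋₊)) := by rw [← Real.exp_nat_mul]; congr 1; ring
    -- Rounding down loses less than one step, a factor `exp γ < e < 3`.
    _ ≤ Real.exp (1 + -(γ * y)) := by
        rw [Real.exp_le_exp]; nlinarith
    _ ≤ 3 * Real.exp (-(γ * y)) := by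
        rw [Real.exp_add]
        gcongr
        linarith [Real.exp_one_lt_d9]

lemma sum_trunc_partAt_le {n k : ℕ} {m : Fin n → ℕ} (Q : Fin k → MultilinearPoly m) {d : ℕ}
    {D : ℝ} (hd : d ≤ D) (i : Fin n) :
    ∑ j, ∑ σ, ((Q j).trunc d).partAt i σ ^ 2 ≤ vecLowInf D i Q := by
  refine Finset.sum_le_sum fun j _ => ?_
  rw [lowInf, Finset.sum_filter]
  refine Finset.sum_le_sum fun σ _ => ?_
  simp only [MultilinearPoly.partAt, MultilinearPoly.trunc]
  by_cases h0 : σ i = 0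
  · simp [h0]
  by_cases h1 : d < σ.degree
  · simp only [h0, h1, if_false, if_true]
    split_ifs <;> simp [sq_nonneg]
  · have h2 : (σ.degree : ℝ) ≤ D := le_trans (by exact_mod_cast not_lt.1 h1) hd
    simp [h0, h1, h2]

/-! ### Assembling the error terms and removing the constant for `chi` -/

section Main

variable {S : Type u} {S' : Type v} [MeasurableSpace S] [MeasurableSpace S'] {P : Measure S}
  {P' : Measure S'} [IsProbabilityMeasure P] [IsProbabilityMeasure P'] {n k : ℕ} {m : Fin n → ℕ}
  {Z : ∀ i, Fin (m i + 1) → S → ℝ} {Z' : ∀ i, Fin (m i + 1) → S' → ℝ} {α τ γ : ℝ}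

/-- The invariance principle for `τ < 1`, up to a constant factor. -/
lemma invariance_of_lt_one (hα : 0 < α) (hα2 : α ≤ 1 / 2)
    (hZ : IsHCSeq (1 / 2 * α ^ (1 / 6 : ℝ)) P Z) (hZ' : IsHCSeq (1 / 2 * α ^ (1 / 6 : ℝ)) P' Z')
    (hτ : 0 < τ) (hτ1 : τ < 1) (hγ : 0 < γ) (hγ1 : γ < 1) (Q : Fin k → MultilinearPoly m)
    (hv : ∑ j, coeffVar (Q j) ≤ 1)
    (hinf : ∀ i, vecLowInf (Real.log (1 / τ) / Real.log (1 / α)) i Q ≤ τ)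
    (htail : ∀ j, ∀ d : ℕ, ∑ σ, (Q j).above d σ ^ 2 ≤ (1 - γ) ^ (2 * d)) :
    |∫ ω, zeta (fun j => (Q j).apply Z ω) ∂P - ∫ ω, zeta (fun j => (Q j).apply Z' ω) ∂P'|
      ≤ (20 * k + 12 * 12 ^ k) * τ ^ (1 / (32 * (k + 1)) * (γ / Real.log (1 / α))) ∧
    |∫ ω, chi (fun j => (Q j).apply Z ω) ∂P - ∫ ω, chi (fun j => (Q j).apply Z' ω) ∂P'|
      ≤ (20 * k + 12 * 12 ^ k) * τ ^ (1 / (32 * (k + 1)) * (γ / Real.log (1 / α))) := by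
  have hK := half_le_log_inv hα hα2
  set K := Real.log (1 / α) with hKd
  have hK0 : 0 < K := by linarith
  have hL0 : 0 < Real.log (1 / τ) := Real.log_pos (by rw [lt_div_iff₀ hτ]; linarith)
  set L := Real.log (1 / τ) with hL
  -- The 18 is the one required by `hypercontractive_loss_le`. It also keeps `d` below `L / K`, so
  -- the influences of the truncated polynomial are covered by the hypothesis.
  set d := ⌊L / (18 * K)⌋₊ with hd
  have hd1 : (d : ℝ) ≤ L / (18 * K) := Nat.floor_le (by positivity)
  have hd2 : d * K ≤ L / 18 := by
    calc d * K ≤ L / (18 * K) * K := by gcongr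
      _ = L / 18 := by field_simp
  have hd3 : (d : ℝ) ≤ L / K := hd1.trans (by gcongr; linarith)
  set T := τ ^ (1 / (32 * (k + 1)) * (γ / K)) with hT
  have hT' : T = Real.exp (-(γ * L / (32 * (k + 1) * K))) := by
    rw [hT, Real.rpow_def_of_pos hτ, hL, one_div τ, Real.log_inv]
    congr 1
    field_simp
  have hT0 : 0 < T := by rw [hT']; exact Real.exp_pos _
  have hk0 : (0 : ℝ) ≤ k := Nat.cast_nonneg k
  -- Thus `l = τ^(1/(16(k+1)))`: small enough that `l ≤ T`, yet `l^(-2k) ≤ exp (L/8)`, so smoothing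
  -- uses up at most half of the available `exp (-L/4)`.
  set l := Real.exp (-(L / (16 * (k + 1)))) with hl
  have hl0 : 0 < l := Real.exp_pos _
  have hl1 : l ≤ 1 := Real.exp_le_one_iff.2 (neg_nonpos.2 (by positivity))
  have hγK : γ / K ≤ 2 := by rw [div_le_iff₀ hK0]; linarith
  have hlT : l ≤ T := by
    rw [hT', hl, Real.exp_le_exp, neg_le_neg_iff]
    calc γ * L / (32 * (k + 1) * K) = γ / K * (L / (32 * (k + 1))) := by field_simp
      _ ≤ 2 * (L / (32 * (k + 1))) := by gcongr
      _ = _ := by field_simp; norm_num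
  have h8 : Real.exp (-(L / 8)) ≤ l := by
    rw [hl, Real.exp_le_exp, neg_le_neg_iff]
    gcongr
    linarith
  have hloss := hypercontractive_loss_le hα hα2 hτ hd2
  set E := (((1 / 2 * α ^ (1 / 6 : ℝ))⁻¹ ^ d) ^ 3 * (√τ * d)) with hE
  have hδ0 : 0 < (1 - γ) ^ d := pow_pos (by linarith) _
  have hδ1 : (1 - γ) ^ d ≤ 1 := pow_le_one₀ (by linarith) (by linarith)
  have hδT : (1 - γ) ^ d ≤ 3 * T := by
    refine (truncation_loss_le hγ1 hγ).trans ?_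
    rw [hT']
    gcongr
    rw [← mul_div_assoc]
    gcongr
    linarith
  have htail' : ∀ j, ∑ σ, (Q j).above d σ ^ 2 ≤ ((1 - γ) ^ d) ^ 2 := fun j => by
    rw [← pow_mul, mul_comm d 2]; exact htail j d
  have hinf' : ∀ i, ∑ j, ∑ σ, ((Q j).trunc d).partAt i σ ^ 2 ≤ τ := fun i =>
    (sum_trunc_partAt_le Q hd3 i).trans (hinf i)
  have hη := eta_pos hα
  have hη1 := (eta_le_half hα hα2).trans (by norm_num : (1 : ℝ) / 2 ≤ 1)
  have h12 : (1 : ℝ) ≤ 12 ^ k := one_le_pow₀ (by norm_num)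
  constructor
  · refine (invariance_zeta hZ hZ' hη hη1 Q hl0 hδ0 hδ1 htail' hinf' hv).trans ?_
    have e1 : 6 / l * E ≤ 6 * T := by
      calc 6 / l * E ≤ 6 / l * Real.exp (-(L / 4)) := by gcongr
        _ = 6 / l * (Real.exp (-(L / 8)) * Real.exp (-(L / 8))) := by
          rw [← Real.exp_add]; congr 2; ring
        _ ≤ 6 / l * (l * T) := by gcongr; exact h8.trans hlT
        _ = 6 * T := by field_simp
    have e2 : l ^ 2 ≤ T := by nlinarith
    have e3 : (k : ℝ) * (1 - γ) ^ d ≤ k * (3 * T) := by gcongr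
    have e4 : (k : ℝ) * l ^ 2 ≤ k * T := by gcongr
    nlinarith [mul_le_mul_of_nonneg_right h12 hT0.le]
  · refine (invariance_chi hZ hZ' hη hη1 Q hl0 hl1 hδ0 htail' hinf' hv).trans ?_
    have e1 : (12 / l ^ 2) ^ k * E ≤ 12 ^ k * T := by
      have hlk : Real.exp (-(L / 8)) ≤ (l ^ 2) ^ k := by
        rw [← pow_mul, hl, ← Real.exp_nat_mul, Real.exp_le_exp]
        push_cast
        have : 2 * k * -(L / (16 * (k + 1))) = -(L / 8 * (k / (k + 1))) := by field_simp; ring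
        rw [this, neg_le_neg_iff]
        exact mul_le_of_le_one_right (by positivity) (div_le_one_of_le₀ (by linarith) (by positivity))
      calc (12 / l ^ 2) ^ k * E ≤ (12 / l ^ 2) ^ k * Real.exp (-(L / 4)) := by gcongr
        _ = (12 / l ^ 2) ^ k * (Real.exp (-(L / 8)) * Real.exp (-(L / 8))) := by
          rw [← Real.exp_add]; congr 2; ring
        _ ≤ (12 / l ^ 2) ^ k * ((l ^ 2) ^ k * T) := by gcongr; exact h8.trans hlT
        _ = 12 ^ k * T := by rw [div_pow]; field_simp
    have e3 : (k : ℝ) * (1 - γ) ^ d ≤ k * (3 * T) := by gcongr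
    have e4 : (k : ℝ) * l ≤ k * T := by gcongr
    have e5 : 0 ≤ (k : ℝ) * T := by positivity
    nlinarith [mul_le_mul_of_nonneg_right h12 hT0.le]

omit [IsProbabilityMeasure P] in
lemma IsEnsembleSeq.trunc_zero_apply (hZ : IsEnsembleSeq P Z) (Q : MultilinearPoly m) (ω : S) :
    (Q.trunc 0).apply Z ω = Q 0 := by
  rw [MultilinearPoly.apply, Finset.sum_eq_single 0 ?_ (by simp), hZ.monomial_zero,
    trunc_apply_zero, mul_one]
  intro σ _ hσ
  rw [trunc_eq_zero, zero_mul]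
  exact Nat.pos_of_ne_zero fun h => hσ (degree_eq_zero_iff.1 h)

/-- A crude bound for `zeta`, which does not need any influence to be small. -/
lemma abs_integral_zeta_sub_le (hZ : IsEnsembleSeq P Z) (hZ' : IsEnsembleSeq P' Z')
    (Q : Fin k → MultilinearPoly m) (hv : ∀ j, coeffVar (Q j) ≤ 1)
    (htail : ∀ j, ∑ σ, (Q j).above 0 σ ^ 2 ≤ 1) :
    |∫ ω, zeta (fun j => (Q j).apply Z ω) ∂P - ∫ ω, zeta (fun j => (Q j).apply Z' ω) ∂P'|
      ≤ 6 * k := by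
  -- Truncation at degree 0 leaves the constant `Q 0`, which is the same for both sequences.
  have h1 := hZ.abs_integral_zeta_trunc_le Q (d := 0) one_pos le_rfl (by simpa using htail) hv
  have h2 := hZ'.abs_integral_zeta_trunc_le Q (d := 0) one_pos le_rfl (by simpa using htail) hv
  simp only [hZ.trunc_zero_apply, hZ'.trunc_zero_apply, integral_const, probReal_univ,
    one_smul] at h1 h2
  rw [abs_le] at *
  constructor <;> linarith [h1.1, h1.2, h2.1, h2.2]

end Main

/-- A constant factor can be absorbed into the exponent, for quantities bounded away from one. -/
lemma exists_exponent_absorbing {δ C : ℝ} (hδ : 0 < δ) (hC : 1 ≤ C) : ∃ c : ℝ, 0 < c ∧ c ≤ 1 ∧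
    ∀ T x : ℝ, 0 < T → T ≤ 1 → x ≤ 1 - δ → x ≤ C * T → x ≤ T ^ c := by
  have hC0 : 0 < C := by linarith
  refine ⟨min (1 / 2) (δ / (2 * C)), lt_min (by norm_num) (by positivity),
    (min_le_left _ _).trans (by norm_num), fun T x hT hT1 hx1 hx2 => ?_⟩
  set c := min (1 / 2) (δ / (2 * C)) with hc
  have hc0 : 0 < c := lt_min (by norm_num) (by positivity)
  -- For `T` bounded below, `T ^ c ≥ 1 + c * log T ≥ 1 - δ` once `c` is small. For smaller `T`, `C *
  -- T ≤ √T`, which explains the cap 1/2 on `c`.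
  rcases le_or_gt 1 (C ^ 2 * T) with h | h
  · refine hx1.trans ?_
    have hlog : -(2 * C) ≤ Real.log T := by
      have h1 := Real.log_nonneg h
      rw [Real.log_mul (by positivity) hT.ne', Real.log_pow] at h1
      have h2 := Real.log_le_sub_one_of_pos hC0
      push_cast at h1
      linarith
    have hcδ : c * (2 * C) ≤ δ := by
      rw [← le_div_iff₀ (by positivity)]; exact min_le_right _ _
    rw [Real.rpow_def_of_pos hT]
    refine le_trans ?_ (Real.add_one_le_exp _)
    nlinarith [mul_le_mul_of_nonneg_left hlog hc0.le]
  · refine hx2.trans ?_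
    have hs : C * √T ≤ 1 := by
      refine abs_le_of_sq_le_sq' ?_ zero_le_one |>.2
      rw [mul_pow, Real.sq_sqrt hT.le]; linarith
    calc C * T = (C * √T) * √T := by rw [mul_assoc, Real.mul_self_sqrt hT.le]
      _ ≤ √T := mul_le_of_le_one_left (Real.sqrt_nonneg _) hs
      _ = T ^ (1 / 2 : ℝ) := Real.sqrt_eq_rpow _
      _ ≤ T ^ c := Real.rpow_le_rpow_of_exponent_ge hT hT1 (min_le_left _ _)

/-- The invariance principle for `zeta` and `chi`, in terms of the coefficients of the
polynomials. -/
theorem exists_invariance_constants (k : ℕ) : ∃ c : ℝ, 0 < c ∧ ∃ C : ℝ, 0 < C ∧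
    ∀ (S : Type u) [MeasurableSpace S] (P : Measure S) [IsProbabilityMeasure P]
      (S' : Type v) [MeasurableSpace S'] (P' : Measure S') [IsProbabilityMeasure P']
      (n : ℕ) (m : Fin n → ℕ) (Z : ∀ i, Fin (m i + 1) → S → ℝ)
      (Z' : ∀ i, Fin (m i + 1) → S' → ℝ) (α τ γ : ℝ) (Q : Fin k → MultilinearPoly m),
      0 < α → α ≤ 1 / 2 → IsHCSeq (1 / 2 * α ^ (1 / 6 : ℝ)) P Z →
      IsHCSeq (1 / 2 * α ^ (1 / 6 : ℝ)) P' Z' → 0 < τ → 0 < γ → γ < 1 →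
      ∑ j, coeffVar (Q j) ≤ 1 →
      (∀ i, vecLowInf (Real.log (1 / τ) / Real.log (1 / α)) i Q ≤ τ) →
      (∀ j, ∀ d : ℕ, ∑ σ, (Q j).above d σ ^ 2 ≤ (1 - γ) ^ (2 * d)) →
      |∫ ω, zeta (fun j => (Q j).apply Z ω) ∂P - ∫ ω, zeta (fun j => (Q j).apply Z' ω) ∂P'|
        ≤ C * τ ^ (c * (γ / Real.log (1 / α))) ∧
      |∫ ω, chi (fun j => (Q j).apply Z ω) ∂P - ∫ ω, chi (fun j => (Q j).apply Z' ω) ∂P'|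
        ≤ τ ^ (c * (γ / Real.log (1 / α))) := by
  obtain ⟨δ, hδ0, hδ1, hgap⟩ := exists_chi_gap.{u, v} k
  have h12 : (1 : ℝ) ≤ 12 ^ k := one_le_pow₀ (by norm_num)
  have hk0 : (0 : ℝ) ≤ k := Nat.cast_nonneg k
  have hC1 : (1 : ℝ) ≤ 20 * k + 12 * 12 ^ k := by linarith
  obtain ⟨c, hc0, hc1, habs⟩ := exists_exponent_absorbing hδ0 hC1
  refine ⟨1 / (32 * (k + 1)) * c, by positivity, 20 * k + 12 * 12 ^ k, by positivity, ?_⟩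
  intro S _ P _ S' _ P' _ n m Z Z' α τ γ Q hα hα2 hZ hZ' hτ hγ hγ1 hv hinf htail
  have hK := half_le_log_inv hα hα2
  have hgap' := hgap S P S' P' (fun j => (Q j).apply Z) (fun j => (Q j).apply Z')
    (fun j => hZ.seq.memLp_apply _) (fun j => hZ'.seq.memLp_apply _)
    (by simpa only [hZ.seq.variance_apply] using hv)
    (by simpa only [hZ'.seq.variance_apply] using hv)
    (fun j => by rw [hZ.seq.integral_apply, hZ'.seq.integral_apply])
  have hpos : 0 ≤ 1 / (32 * (k + 1)) * (γ / Real.log (1 / α)) := by positivity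
  have hexp : 1 / (32 * (k + 1)) * c * (γ / Real.log (1 / α))
      = 1 / (32 * (k + 1)) * (γ / Real.log (1 / α)) * c := by ring
  rw [hexp]
  rcases lt_or_ge τ 1 with hτ1 | hτ1
  · obtain ⟨h1, h2⟩ := invariance_of_lt_one hα hα2 hZ hZ' hτ hτ1 hγ hγ1 Q hv hinf htail
    rw [Real.rpow_mul hτ.le]
    set T := τ ^ (1 / (32 * (k + 1)) * (γ / Real.log (1 / α)))
    have hT0 : 0 < T := Real.rpow_pos_of_pos hτ _
    have hT1 : T ≤ 1 := Real.rpow_le_one hτ.le hτ1.le hpos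
    refine ⟨h1.trans ?_, habs T _ hT0 hT1 hgap' h2⟩
    gcongr
    simpa using Real.rpow_le_rpow_of_exponent_ge hT0 hT1 hc1
  -- For `τ ≥ 1` the `chi` bound is trivial. The function `zeta` is unbounded and needs the crude
  -- estimate, where `6k` is at most the constant.
  · have hT : 1 ≤ τ ^ (1 / (32 * (k + 1)) * (γ / Real.log (1 / α)) * c) :=
      Real.one_le_rpow hτ1 (by positivity)
    refine ⟨?_, by linarith⟩
    have hvj : ∀ j, coeffVar (Q j) ≤ 1 := fun j =>
      (Finset.single_le_sum (fun j _ => coeffVar_nonneg (Q j)) (Finset.mem_univ j)).trans hv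
    refine (abs_integral_zeta_sub_le hZ.seq hZ'.seq Q hvj fun j => by simpa using htail j 0).trans ?_
    nlinarith

/-! ### Linear substitutions -/

lemma sum_above_sq {n : ℕ} {m : Fin n → ℕ} (Q : MultilinearPoly m) (d : ℕ) :
    ∑ σ, Q.above d σ ^ 2 = coeffVar (Q.above d) := by
  refine Finset.sum_congr rfl fun σ _ => ?_
  simp only [MultilinearPoly.above]
  by_cases h : σ.degree = 0 <;> simp [h]

/-- The polynomial obtained from `Q` by substituting linear combinations for the variables. -/
def MultilinearPoly.subst {n : ℕ} {m M : Fin n → ℕ} (a : ∀ i, Fin (M i + 1) → Fin (m i + 1) → ℝ)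
    (Q : MultilinearPoly M) : MultilinearPoly m :=
  fun ρ => ∑ σ, Q σ * ∏ i, a i (σ i) (ρ i)

section Subst

variable {S : Type*} [MeasurableSpace S] {P : Measure S}
  {n : ℕ} {m M : Fin n → ℕ} {Z : ∀ i, Fin (m i + 1) → S → ℝ}
  {a : ∀ i, Fin (M i + 1) → Fin (m i + 1) → ℝ}

omit [MeasurableSpace S] in
lemma subst_apply (Q : MultilinearPoly M) (Z : ∀ i, Fin (m i + 1) → S → ℝ) :
    (Q.subst a).apply Z = Q.apply (linComb a Z) := by
  funext ω
  simp only [MultilinearPoly.apply, MultilinearPoly.subst, linComb, Finset.prod_univ_sum,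
    Finset.mul_sum, Finset.sum_mul, Fintype.piFinset_univ]
  rw [Finset.sum_comm]
  refine Finset.sum_congr rfl fun σ _ => Finset.sum_congr rfl fun ρ _ => ?_
  rw [Finset.prod_mul_distrib]
  ring

lemma isEnsembleSeq_linComb (hZ : IsEnsembleSeq P Z)
    (ha : ∀ i, IsOrthonormalEnsemble P (linComb a Z i)) : IsEnsembleSeq P (linComb a Z) :=
  ⟨ha, hZ.indep.comp (fun i x s => ∑ r, a i s r * x r) fun i => by fun_prop⟩

lemma integral_linComb_mul (hZ : IsEnsembleSeq P Z) (i : Fin n) (s : Fin (M i + 1))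
    (r : Fin (m i + 1)) : ∫ ω, linComb a Z i s ω * Z i r ω ∂P = a i s r := by
  simp only [linComb, Finset.sum_mul, mul_assoc]
  have hi : ∀ t, Integrable (fun ω => a i s t * (Z i t ω * Z i r ω)) P := fun t =>
    (((hZ.ensemble i).memLp t).integrable_mul ((hZ.ensemble i).memLp r)).const_mul _
  rw [integral_finsetSum _ fun t _ => hi t]
  simp [integral_const_mul, (hZ.ensemble i).orthonormal]

/-- The coefficient is an inner product of an old and a new variable. If exactly one index is 0, it
is the mean of a variable orthogonal to 1. Hence substitution never changes the support of a
monomial. -/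
lemma coeff_eq_zero_of_ne (hZ : IsEnsembleSeq P Z)
    (ha : ∀ i, IsOrthonormalEnsemble P (linComb a Z i)) (i : Fin n) (s : Fin (M i + 1))
    (r : Fin (m i + 1)) (h : ¬(s = 0 ↔ r = 0)) : a i s r = 0 := by
  rw [← integral_linComb_mul (a := a) hZ i s r]
  by_cases hs : s = 0
  · have hr : r ≠ 0 := fun hr => h (by simp [hs, hr])
    have := (hZ.ensemble i).orthonormal 0 r
    simp only [(hZ.ensemble i).zero_eq_one, hr.symm, if_false] at this
    simpa only [hs, (ha i).zero_eq_one] using this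
  · have hr : r = 0 := by by_contra hr; exact h (by simp [hs, hr])
    have := (ha i).orthonormal s 0
    simp only [(ha i).zero_eq_one, hs, if_false] at this
    simpa only [hr, (hZ.ensemble i).zero_eq_one] using this

/-- The support of a multi-index. -/
def MultiIndex.supp {n : ℕ} {m : Fin n → ℕ} (σ : MultiIndex m) : Finset (Fin n) :=
  Finset.univ.filter fun i => σ i ≠ 0

lemma prod_coeff_eq_zero (hZ : IsEnsembleSeq P Z)
    (ha : ∀ i, IsOrthonormalEnsemble P (linComb a Z i)) {σ : MultiIndex M} {ρ : MultiIndex m}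
    (h : σ.supp ≠ ρ.supp) : ∏ i, a i (σ i) (ρ i) = 0 := by
  by_contra h0
  refine h (Finset.ext fun i => ?_)
  have := Finset.prod_ne_zero_iff.1 h0 i (Finset.mem_univ i)
  simp only [MultiIndex.supp, Finset.mem_filter, Finset.mem_univ, true_and]
  by_contra h1
  exact this (coeff_eq_zero_of_ne hZ ha i _ _ (by tauto))

open Classical in
/-- A substitution of orthonormal linear combinations preserves the weight of any set of
supports. -/
lemma sum_subst_sq [IsProbabilityMeasure P] (hZ : IsEnsembleSeq P Z)
    (ha : ∀ i, IsOrthonormalEnsemble P (linComb a Z i)) (Q : MultilinearPoly M)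
    (g : Finset (Fin n) → Prop) :
    ∑ ρ, (if g ρ.supp then Q.subst a ρ ^ 2 else 0) = ∑ σ, if g σ.supp then Q σ ^ 2 else 0 := by
  set Qg : MultilinearPoly M := fun σ => if g σ.supp then Q σ else 0 with hQg
  -- Because supports are preserved, substitution commutes with restriction to the supports
  -- satisfying `g`.
  have e1 : ∀ ρ, Qg.subst a ρ = if g ρ.supp then Q.subst a ρ else 0 := by
    intro ρ
    simp only [MultilinearPoly.subst, hQg]
    by_cases hg : g ρ.supp
    · rw [if_pos hg]
      refine Finset.sum_congr rfl fun σ _ => ?_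
      by_cases h : σ.supp = ρ.supp
      · rw [h, if_pos hg]
      · rw [prod_coeff_eq_zero hZ ha h, mul_zero, mul_zero]
    · rw [if_neg hg]
      refine Finset.sum_eq_zero fun σ _ => ?_
      by_cases h : σ.supp = ρ.supp
      · rw [h, if_neg hg, zero_mul]
      · rw [prod_coeff_eq_zero hZ ha h, mul_zero]
  -- Parseval twice: both sums are the second moment of one random variable, expanded over the old
  -- and over the new ensembles.
  have e2 := hZ.integral_apply_sq (Qg.subst a)
  rw [subst_apply, (isEnsembleSeq_linComb hZ ha).integral_apply_sq] at e2
  simp only [e1] at e2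
  simp only [hQg, ite_pow, ne_eq, OfNat.ofNat_ne_zero, not_false_eq_true, zero_pow] at e2
  exact e2.symm

variable [IsProbabilityMeasure P]

lemma coeffVar_subst (hZ : IsEnsembleSeq P Z)
    (ha : ∀ i, IsOrthonormalEnsemble P (linComb a Z i)) (Q : MultilinearPoly M) :
    coeffVar (Q.subst a) = coeffVar Q := by
  have := sum_subst_sq hZ ha Q fun s => s.card ≠ 0
  simpa only [coeffVar, MultiIndex.degree, MultiIndex.supp, ne_eq, ite_not] using this

lemma sum_above_subst_sq (hZ : IsEnsembleSeq P Z)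
    (ha : ∀ i, IsOrthonormalEnsemble P (linComb a Z i)) (Q : MultilinearPoly M) (d : ℕ) :
    ∑ ρ, (Q.subst a).above d ρ ^ 2 = ∑ σ, Q.above d σ ^ 2 := by
  have := sum_subst_sq hZ ha Q fun s => d < s.card
  simpa [MultilinearPoly.above, MultiIndex.degree, MultiIndex.supp, ite_pow] using this

lemma lowInf_subst (hZ : IsEnsembleSeq P Z)
    (ha : ∀ i, IsOrthonormalEnsemble P (linComb a Z i)) (Q : MultilinearPoly M) (D : ℝ)
    (i : Fin n) : lowInf D i (Q.subst a) = lowInf D i Q := by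
  have := sum_subst_sq hZ ha Q fun s => (s.card : ℝ) ≤ D ∧ i ∈ s
  simpa [lowInf, MultiIndex.degree, MultiIndex.supp, Finset.sum_filter] using this

end Subst

/-! ### Single-ensemble hypercontractivity under hypothesis H3, and the theorem -/

lemma HypothesisH3.isHCSeq_productSeq {n : ℕ} {m : Fin n → ℕ} {Ω : Fin n → Type*}
    [∀ i, Fintype (Ω i)] [∀ i, MeasurableSpace (Ω i)] [∀ i, MeasurableSingletonClass (Ω i)]
    {μ : ∀ i, Measure (Ω i)} [∀ i, IsProbabilityMeasure (μ i)]
    {φ : ∀ i, Fin (m i + 1) → Ω i → ℝ} {S : Type*} [MeasurableSpace S] {P : Measure S}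
    {Y : ∀ i, Fin (m i + 1) → S → ℝ} {α : ℝ} (h : HypothesisH3 μ φ P Y α) :
    IsHCSeq (1 / 2 * α ^ (1 / 6 : ℝ)) (Measure.pi μ) (productSeq φ) :=
  MLInv.isHCSeq_productSeq h.ensemble h.alpha_pos h.atom_ge (eta_pos h.alpha_pos)
    (eta_le_half h.alpha_pos h.alpha_le) (eta_pow_three h.alpha_pos).le

lemma HypothesisH3.isHCSeq {n : ℕ} {m : Fin n → ℕ} {Ω : Fin n → Type*}
    [∀ i, Fintype (Ω i)] [∀ i, MeasurableSpace (Ω i)]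
    {μ : ∀ i, Measure (Ω i)} {φ : ∀ i, Fin (m i + 1) → Ω i → ℝ} {S : Type*} [MeasurableSpace S]
    {P : Measure S} [IsProbabilityMeasure P]
    {Y : ∀ i, Fin (m i + 1) → S → ℝ} {α : ℝ} (h : HypothesisH3 μ φ P Y α) :
    IsHCSeq (1 / 2 * α ^ (1 / 6 : ℝ)) P Y :=
  ⟨h.ensembleSeq, h.ensembleSeq.isHC_of_isHypercontractive h.hypercontractive⟩

end MLInv

theorem theorem4p2 (k : ℕ) :
    ∃ c : ℝ, 0 < c ∧ ∃ C : ℝ, 0 < C ∧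
      -- the theorem
      (∀ (n : ℕ) (m : Fin n → ℕ)
        (Ω : Fin n → Type u) [∀ i, Fintype (Ω i)] [∀ i, MeasurableSpace (Ω i)]
        [∀ i, MeasurableSingletonClass (Ω i)]
        (μ : ∀ i, Measure (Ω i)) [∀ i, IsProbabilityMeasure (μ i)]
        (φ : ∀ i, Fin (m i + 1) → Ω i → ℝ)
        (S : Type v) [MeasurableSpace S] (P : Measure S) [IsProbabilityMeasure P]
        (Y : ∀ i, Fin (m i + 1) → S → ℝ)
        (α τ γ : ℝ) (Q : Fin k → MultilinearPoly m),
        HypothesisH3 μ φ P Y α → 0 < τ → 0 < γ → γ < 1 →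
        vecVariance (Measure.pi μ) (fun j => (Q j).apply (productSeq φ)) ≤ 1 →
        (∀ i, vecLowInf (Real.log (1 / τ) / Real.log (1 / α)) i Q ≤ τ) →
        (∀ d : ℕ, vecVariance (Measure.pi μ) (fun j => ((Q j).above d).apply (productSeq φ))
          ≤ (1 - γ) ^ (2 * d)) →
        |(∫ ω, zeta (fun j => (Q j).apply (productSeq φ) ω) ∂(Measure.pi μ))
            - ∫ ω, zeta (fun j => (Q j).apply Y ω) ∂P|
          ≤ C * τ ^ (c * (γ / Real.log (1 / α))) ∧
        |(∫ ω, chi (fun j => (Q j).apply (productSeq φ) ω) ∂(Measure.pi μ))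
            - ∫ ω, chi (fun j => (Q j).apply Y ω) ∂P|
          ≤ τ ^ (c * (γ / Real.log (1 / α)))) ∧
      -- the corollary for ensembles of linear combinations
      (∀ (n : ℕ) (m : Fin n → ℕ)
        (Ω : Fin n → Type u) [∀ i, Fintype (Ω i)] [∀ i, MeasurableSpace (Ω i)]
        [∀ i, MeasurableSingletonClass (Ω i)]
        (μ : ∀ i, Measure (Ω i)) [∀ i, IsProbabilityMeasure (μ i)]
        (φ : ∀ i, Fin (m i + 1) → Ω i → ℝ)
        (S : Type v) [MeasurableSpace S] (P : Measure S) [IsProbabilityMeasure P]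
        (Y : ∀ i, Fin (m i + 1) → S → ℝ)
        (M : Fin k → Fin n → ℕ) (a : ∀ j i, Fin (M j i + 1) → Fin (m i + 1) → ℝ)
        (α τ γ : ℝ) (Q : ∀ j, MultilinearPoly (M j)),
        HypothesisH3 μ φ P Y α → 0 < τ → 0 < γ → γ < 1 →
        (∀ j i, IsOrthonormalEnsemble (Measure.pi μ) (linComb (a j) (productSeq φ) i)) →
        (∀ j i, IsOrthonormalEnsemble P (linComb (a j) Y i)) →
        vecVariance (Measure.pi μ) (fun j => (Q j).apply (linComb (a j) (productSeq φ))) ≤ 1 →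
        (∀ i, vecLowInf (Real.log (1 / τ) / Real.log (1 / α)) i Q ≤ τ) →
        (∀ j, ∀ d : ℕ, variance (((Q j).above d).apply (linComb (a j) (productSeq φ)))
          (Measure.pi μ) ≤ (1 - γ) ^ (2 * d)) →
        |(∫ ω, zeta (fun j => (Q j).apply (linComb (a j) (productSeq φ)) ω) ∂(Measure.pi μ))
            - ∫ ω, zeta (fun j => (Q j).apply (linComb (a j) Y) ω) ∂P|
          ≤ C * τ ^ (c * (γ / Real.log (1 / α))) ∧
        |(∫ ω, chi (fun j => (Q j).apply (linComb (a j) (productSeq φ)) ω) ∂(Measure.pi μ))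
            - ∫ ω, chi (fun j => (Q j).apply (linComb (a j) Y) ω) ∂P|
          ≤ τ ^ (c * (γ / Real.log (1 / α)))) := by
  obtain ⟨c, hc, C, hC, main⟩ := exists_invariance_constants.{u, v} k
  refine ⟨c, hc, C, hC, ?_, ?_⟩
  · intro n m Ω _ _ _ μ _ φ S _ P _ Y α τ γ Q h hτ hγ hγ1 hv hinf htail
    have hX := h.isHCSeq_productSeq
    refine main _ (Measure.pi μ) S P n m (productSeq φ) Y α τ γ Q h.alpha_pos h.alpha_le hX
      h.isHCSeq hτ hγ hγ1 ?_ hinf fun j d => ?_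
    · rw [vecVariance_eq_sum fun j => hX.seq.memLp_apply (Q j)] at hv
      simpa only [hX.seq.variance_apply] using hv
    -- The core only uses the tails of the single components; here they are bounded by the tail of
    -- the whole vector.
    · refine le_trans ?_ (htail d)
      rw [vecVariance_eq_sum fun j => hX.seq.memLp_apply ((Q j).above d)]
      simp only [hX.seq.variance_apply, sum_above_sq]
      exact Finset.single_le_sum (f := fun j => coeffVar ((Q j).above d))
        (fun j _ => coeffVar_nonneg _) (Finset.mem_univ j)
  · intro n m Ω _ _ _ μ _ φ S _ P _ Y M a α τ γ Q h hτ hγ hγ1 haX _ hv hinf htail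
    have hX := h.isHCSeq_productSeq
    have hXj := fun j => isEnsembleSeq_linComb hX.seq (haX j)
    have key := main _ (Measure.pi μ) S P n m (productSeq φ) Y α τ γ
      (fun j => (Q j).subst (a j)) h.alpha_pos h.alpha_le hX h.isHCSeq hτ hγ hγ1
    -- The common coefficients `a` make one substituted polynomial represent both `Q_j(𝒳^j)` and
    -- `Q_j(𝒴^j)`, while orthonormality of the `𝒳^j` transfers the three coefficient conditions.
    simp only [subst_apply, coeffVar_subst hX.seq (haX _), vecLowInf,
      lowInf_subst hX.seq (haX _), sum_above_subst_sq hX.seq (haX _)] at key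
    refine key ?_ hinf fun j d => ?_
    · rw [vecVariance_eq_sum fun j => (hXj j).memLp_apply (Q j)] at hv
      simpa only [(hXj _).variance_apply] using hv
    · rw [sum_above_sq, ← (hXj j).variance_apply]
      exact htail j d
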